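/- Let $K$ be a number field, let $d\ge 2$ and $n\ge 0$ be integers, let $s_1,\dots,s_{d-1},t$ be independent transcendentals over $K$, and put $K_{s,t}=K(s_1,\dots,s_{d-1},t)$. Let $f(x)=x^d+s_1x^{d-1}+\dots+s_{d-1}x+t\in K_{s,t}[x]$ be the generic monic polynomial of degree $d$, let $f'$ be its derivative, and, for $\beta$ in an algebraic closure $\overline{K_{s,t}}$, let $f^{-n}(\beta)$ be the set of all $x\in\overline{K_{s,t}}$ with $f^n(x)=\beta$, where $f^n$ is the $n$-th iterate of $f$. Let $[S_d]^n$ denote the $n$-th iterated wreath product of the symmetric group $S_d$, that is, $[S_d]^0=1$ and $[S_d]^{m+1}=([S_d]^m)^d\rtimes S_d$ with $S_d$ permuting the $d$ factors. Then $K_{s,t}\big(\bigcup_{f'(\beta)=0}f^{-n}(\beta)\big)$ is a Galois extension of the splitting field $K_{s,t}\big((f')^{-1}(0)\big)$ of $f'$, and $$\mathrm{Gal}\Big(K_{s,t}\Big(\bigcup_{f'(\beta)=0}f^{-n}(\beta)\Big)\Big/K_{s,t}\big((f')^{-1}(0)\big)\Big)\;\cong\;\prod_{d-1}[S_d]^n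 ,$$ the product of $d-1$ copies of $[S_d]^n$. -/

import Mathlib

open Polynomial

/-- The monic polynomial `x ^ d + s₁ x ^ (d - 1) + ⋯ + s_{d-1} x + t`; here `s i` is the
coefficient written `s_{i+1}`, since `i` runs through `0, …, d - 2`. -/
noncomputable def monicPoly {F : Type*} [Field F] (d : ℕ) (s : Fin (d - 1) → F) (t : F) : F[X] :=
  X ^ d + ∑ i : Fin (d - 1), C (s i) * X ^ (d - (i.val + 1)) + C t

/-- `(f')⁻¹(0)`: the critical points of `f` in the extension `Ω`. -/
def criticalPoints {F : Type*} (Ω : Type*) [Field F] [Field Ω] [Algebra F Ω] (f : F[X]) : Set Ω :=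
  {β | aeval β (derivative f) = 0}

/-- `f⁻ⁿ(β)`: the points `x` of `Ω` whose `n`-th iterate under `f` is `β`. -/
def iteratedPreimage {F Ω : Type*} [Field F] [Field Ω] [Algebra F Ω] (f : F[X]) (n : ℕ) (β : Ω) :
    Set Ω :=
  {x | (fun y : Ω => aeval y f)^[n] x = β}

/-- The field `F((f')⁻¹(0))` inside `Ω`. -/
noncomputable def criticalField {F : Type*} (Ω : Type*) [Field F] [Field Ω] [Algebra F Ω]
    (f : F[X]) : IntermediateField F Ω :=
  IntermediateField.adjoin F (criticalPoints Ω f)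

/-- The field `F(⋃_{f'(β) = 0} f⁻ⁿ(β))` inside `Ω`. -/
noncomputable def preimageField {F : Type*} (Ω : Type*) [Field F] [Field Ω] [Algebra F Ω]
    (f : F[X]) (n : ℕ) : IntermediateField F Ω :=
  IntermediateField.adjoin F (⋃ β ∈ criticalPoints Ω f, iteratedPreimage f n β)

/-- The `n`-th iterated (permutational) wreath product `[S_d]ⁿ`: the group `[S_d]⁰` is trivial and
`[S_d]ⁿ⁺¹ = ([S_d]ⁿ)ᵈ ⋊ S_d`, where `S_d` permutes the `d` coordinates. -/
noncomputable def iteratedWreath (d : ℕ) : ℕ → GrpCat.{0}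
  | 0 => GrpCat.of PUnit
  | n + 1 => GrpCat.of ((Fin d → iteratedWreath d n) ⋊[mulAutArrow] Equiv.Perm (Fin d))

/-! Put r = d - 1. In characteristic zero f equals `critPoly γ + t`, where γ lists its r critical
points, so the splitting field B of f' is K(γ, t). A count of transcendence degree shows that γ and
t are again independent (`exists_critical_parametrization`). Independence excludes every relation
f^(m+1)(γ_i) = γ_l, so no fibre in the backward orbits of the critical points contains a critical
point. These orbits form r regular d-ary trees on which the Galois group of the algebraic closure of
B acts, fixing the roots. This gives a homomorphism to the product of r copies of [S_d]^n whose
kernel fixes exactly the n-th preimages; what has to be shown is that it is onto.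

By a count of indices it suffices that, for each m, the pointwise stabiliser of level m permutes the
children of the vertices of level m by the full product of symmetric groups. Transpositions generate
S_d, so this follows (`RegularForest.portraitHom_surjective`) from three existence statements for
each tree and level: some automorphism swaps two siblings and fixes the rest of that level in all
trees; the children of some vertex are permuted transitively; the stabiliser of some child is
transitive on its siblings. The last two make the action transitive on ordered pairs of siblings, so
one swap has every other swap as a conjugate.

Each existence statement is proved for one well-chosen specialisation over a Laurent series field M
= Frac k[[X]]. If its parameters are still independent over K, then B embeds in M and automorphisms
over M restrict to automorphisms over B (`exists_ringHom_of_algebraicIndependent`). For transitivity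
all critical points collapse to 0 modulo X, and a fibre becomes the root set of an Eisenstein
polynomial. For the stabilisers one other critical point is kept away from 0, which leaves one
rational root and an Eisenstein factor of degree r. For the swap, γ is constant and t = τ + X, where
τ makes γ_j periodic of exact period n + 1 with no other critical relation up to that length; only
one fibre ramifies, and only at a double root. Such a τ exists by counting roots
(`exists_unique_critical_relation`): separability is the Gleason argument modulo a prime dividing d,
and relations for two different critical points are excluded by an escape estimate over ℂ. -/

/-! ### Groups acting on regular rooted forests -/

/-- The defining recursion of `iteratedWreath` as a group isomorphism. -/
noncomputable def iteratedWreathSucc (d n : ℕ) : iteratedWreath d (n + 1) ≃*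
    (Fin d → iteratedWreath d n) ⋊[mulAutArrow] Equiv.Perm (Fin d) :=
  MulEquiv.refl _

instance finite_iteratedWreath (d : ℕ) : ∀ n, Finite (iteratedWreath d n)
  | 0 => inferInstanceAs (Finite PUnit)
  | n + 1 => by
    have := finite_iteratedWreath d n
    exact Finite.of_equiv _ (SemidirectProduct.equivProd.symm.trans
      (iteratedWreathSucc d n).symm.toEquiv)

theorem card_iteratedWreath (d n : ℕ) :
    Nat.card (iteratedWreath d n) = d.factorial ^ ∑ i ∈ Finset.range n, d ^ i := by
  induction n with
  | zero => exact (Nat.card_unique (α := PUnit)).trans (by simp)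
  | succ n ih =>
    rw [Nat.card_congr ((iteratedWreathSucc d n).toEquiv.trans SemidirectProduct.equivProd),
      Nat.card_prod, Nat.card_fun, Nat.card_perm, ih, Nat.card_fin, geom_sum_succ, pow_succ,
      ← pow_mul, mul_comm d]

/-- A forest in which every vertex has `d` children, with an action of a group `G` by
automorphisms fixing the roots. -/
structure RegularForest (G S ι : Type*) [Group G] [MulAction G S] (d : ℕ) where
  /-- the roots -/
  root : ι → S
  /-- the labelled children of a vertex -/
  child : S → Fin d → S
  root_injective : Function.Injective root
  smul_root : ∀ (g : G) i, g • root i = root i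
  child_inj : ∀ {x y i j}, child x i = child y j → x = y ∧ i = j
  exists_smul_child : ∀ (g : G) x i, ∃ j, g • child x i = child (g • x) j

namespace RegularForest

variable {G S ι : Type*} [Group G] [MulAction G S] {d : ℕ} (T : RegularForest G S ι d)

/-- The vertices at distance `n` below the root `i`. -/
def level (i : ι) : ℕ → Set S
  | 0 => {T.root i}
  | n + 1 => {x | ∃ y ∈ level i n, ∃ j, T.child y j = x}

/-- The permutation of labels by which `g` maps the children of `x` to those of `g • x`. -/
noncomputable def perm (g : G) (x : S) : Equiv.Perm (Fin d) :=
  Equiv.ofBijective (fun i => (T.exists_smul_child g x i).choose) <| by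
    refine Finite.injective_iff_bijective.1 fun i j h => ?_
    have hi := (T.exists_smul_child g x i).choose_spec
    have hj := (T.exists_smul_child g x j).choose_spec
    rw [show (T.exists_smul_child g x i).choose = _ from h, ← hj] at hi
    exact (T.child_inj (smul_left_cancel g hi)).2

theorem smul_child (g : G) (x : S) (i : Fin d) :
    g • T.child x i = T.child (g • x) (T.perm g x i) :=
  (T.exists_smul_child g x i).choose_spec

theorem perm_mul (g h : G) (x : S) : T.perm (g * h) x = T.perm g (h • x) * T.perm h x := by
  ext1 i
  have h1 := T.smul_child (g * h) x i
  rw [mul_smul, smul_child, smul_child, mul_smul] at h1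
  exact (T.child_inj h1).2.symm

/-- The element of the iterated wreath product describing `g` on the first `n` levels below `x`. -/
noncomputable def portrait (g : G) : ∀ n, S → iteratedWreath d n
  | 0, _ => 1
  -- Coordinate `i` describes `g` below the child that is sent to label `i`, not below the child
  -- with label `i`: this is the normal form for a semidirect product with the tuple on the left.
  | n + 1, x => (iteratedWreathSucc d n).symm
      ⟨fun i => portrait g n (T.child x ((T.perm g x)⁻¹ i)), T.perm g x⟩

/-- A cocycle rule, which becomes multiplicativity at the roots because they are fixed. -/
theorem portrait_mul (g h : G) (n : ℕ) (x : S) :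
    T.portrait (g * h) n x = T.portrait g n (h • x) * T.portrait h n x := by
  induction n generalizing x with
  | zero => exact (mul_one _).symm
  | succ n ih =>
    simp only [portrait]
    rw [← map_mul]
    congr 1
    refine SemidirectProduct.ext (funext fun i => ?_) (T.perm_mul g h x)
    simp only [SemidirectProduct.mul_left, Pi.mul_apply, perm_mul, mul_inv_rev, ih, smul_child,
      ← Equiv.Perm.mul_apply, mul_inv_cancel_left]
    rfl

/-- The action of `G` on the first `n` levels of the forest. -/
noncomputable def portraitHom (n : ℕ) : G →* (ι → iteratedWreath d n) where
  toFun g i := T.portrait g n (T.root i)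
  map_one' := by
    funext i
    have h := T.portrait_mul 1 1 n (T.root i)
    rw [one_smul, mul_one] at h
    exact (left_eq_mul.1 h)
  map_mul' g h := by
    funext i
    rw [portrait_mul, smul_root]
    rfl

/-- The vertices `n` levels below `x`. -/
def below : ℕ → S → Set S
  | 0, x => {x}
  | n + 1, x => {z | ∃ i, z ∈ below n (T.child x i)}

theorem exists_mem_below_of_mem_below_succ {n : ℕ} {x z : S} (h : z ∈ T.below (n + 1) x) :
    ∃ y ∈ T.below n x, ∃ j, T.child y j = z := by
  induction n generalizing x with
  | zero =>
    obtain ⟨i, hi⟩ := h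
    exact ⟨x, rfl, i, (show z = _ from hi).symm⟩
  | succ n ih =>
    obtain ⟨i, hi⟩ := h
    obtain ⟨y, hy, j, hj⟩ := ih hi
    exact ⟨y, ⟨i, hy⟩, j, hj⟩

theorem child_mem_below {n : ℕ} {x y : S} (h : y ∈ T.below n x) (j : Fin d) :
    T.child y j ∈ T.below (n + 1) x := by
  induction n generalizing x with
  | zero =>
    obtain rfl : y = x := h
    exact ⟨j, rfl⟩
  | succ n ih =>
    obtain ⟨i, hi⟩ := h
    exact ⟨i, ih hi⟩

theorem below_root (i : ι) (n : ℕ) : T.below n (T.root i) = T.level i n := by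
  induction n with
  | zero => rfl
  | succ n ih =>
    ext z
    constructor
    · intro h
      obtain ⟨y, hy, j, hj⟩ := T.exists_mem_below_of_mem_below_succ h
      exact ⟨y, ih ▸ hy, j, hj⟩
    · rintro ⟨y, hy, j, rfl⟩
      exact T.child_mem_below (ih ▸ hy) j

/-- A child determines its parent, so fixing the vertices `n` levels down fixes everything in
between; `NeZero d` gives each intermediate vertex such a descendant. -/
theorem portrait_eq_one_iff [NeZero d] (g : G) (n : ℕ) (x : S) (hx : g • x = x) :
    T.portrait g n x = 1 ↔ ∀ z ∈ T.below n x, g • z = z := by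
  induction n generalizing x with
  | zero => simp [portrait, below, hx]
  | succ n ih =>
    rw [portrait, MulEquiv.map_eq_one_iff, SemidirectProduct.ext_iff]
    simp only [SemidirectProduct.one_left, SemidirectProduct.one_right]
    have key : T.perm g x = 1 ↔ ∀ i, g • T.child x i = T.child x i := by
      refine ⟨fun h i => by rw [smul_child, hx, h]; rfl, fun h => Equiv.ext fun i => ?_⟩
      have := h i
      rw [smul_child, hx] at this
      exact (T.child_inj this).2
    constructor
    · rintro ⟨hl, hr⟩ z ⟨i, hi⟩
      refine (ih _ (key.1 hr i)).1 ?_ z hi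
      have := congrFun hl i
      simpa [hr] using this
    · intro h
      have parent : ∀ m z y, y ∈ T.below m z → g • y = y → g • z = z := by
        intro m
        induction m with
        | zero =>
          intro z y hy hg
          obtain rfl : y = z := hy
          exact hg
        | succ m ihm =>
          rintro z y ⟨i, hi⟩ hg
          have := ihm _ _ hi hg
          rw [smul_child] at this
          exact (T.child_inj this).1
      have nonempty : ∀ m z, (T.below m z).Nonempty := by
        intro m
        induction m with
        | zero => exact fun z => ⟨z, rfl⟩
        | succ m ihm => exact fun z => (ihm (T.child z 0)).imp fun y hy => ⟨0, hy⟩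
      have hc : ∀ i, g • T.child x i = T.child x i := fun i =>
        let ⟨y, hy⟩ := nonempty n (T.child x i)
        parent n _ y hy (h y ⟨i, hy⟩)
      have hr := key.2 hc
      refine ⟨funext fun i => ?_, hr⟩
      rw [hr]
      exact (ih _ (hc _)).2 fun z hz => h z ⟨_, hz⟩

theorem mem_ker_portraitHom [NeZero d] (g : G) (n : ℕ) :
    g ∈ (T.portraitHom n).ker ↔ ∀ i, ∀ z ∈ T.level i n, g • z = z := by
  rw [MonoidHom.mem_ker, funext_iff]
  refine forall_congr' fun i => ?_
  rw [← below_root]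
  exact T.portrait_eq_one_iff g n _ (T.smul_root g i)

theorem smul_mem_level {n : ℕ} {i : ι} {x : S} (g : G) (hx : x ∈ T.level i n) :
    g • x ∈ T.level i n := by
  induction n generalizing x with
  | zero =>
    obtain rfl : x = _ := hx
    exact T.smul_root g i
  | succ n ih =>
    obtain ⟨y, hy, a, rfl⟩ := hx
    exact ⟨_, ih hy, _, (T.smul_child g y a).symm⟩

/-- All vertices at distance `n` from the roots. -/
abbrev Level (n : ℕ) : Type _ := {x : S // ∃ i, x ∈ T.level i n}

/-- Vertices of a level are numbered by their parents and their labels. -/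
noncomputable def levelSuccEquiv (n : ℕ) : T.Level n × Fin d ≃ T.Level (n + 1) :=
  Equiv.ofBijective (fun p => ⟨T.child p.1.1 p.2, p.1.2.imp fun _ h => ⟨_, h, _, rfl⟩⟩) <| by
    constructor
    · rintro ⟨⟨x, hx⟩, a⟩ ⟨⟨y, hy⟩, b⟩ h
      obtain ⟨rfl, rfl⟩ := T.child_inj (Subtype.ext_iff.1 h)
      rfl
    · rintro ⟨_, i, y, hy, a, rfl⟩
      exact ⟨⟨⟨y, i, hy⟩, a⟩, rfl⟩

/-- The roots form level zero. -/
noncomputable def levelZeroEquiv : ι ≃ T.Level 0 :=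
  Equiv.ofBijective (fun i => ⟨T.root i, i, rfl⟩) <| by
    constructor
    · exact fun i j h => T.root_injective (Subtype.ext_iff.1 h)
    · rintro ⟨x, i, hx⟩
      exact ⟨i, Subtype.ext (show x = _ from hx).symm⟩

theorem finite_level [Finite ι] (n : ℕ) : Finite (T.Level n) := by
  induction n with
  | zero => exact Finite.of_equiv _ T.levelZeroEquiv
  | succ n ih => exact Finite.of_equiv _ (T.levelSuccEquiv n)

theorem card_level [Finite ι] (n : ℕ) : Nat.card (T.Level n) = Nat.card ι * d ^ n := by
  induction n with
  | zero => rw [← Nat.card_congr T.levelZeroEquiv, pow_zero, mul_one]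
  | succ n ih =>
    rw [← Nat.card_congr (T.levelSuccEquiv n), Nat.card_prod, ih, Nat.card_fin, pow_succ, mul_assoc]

/-- The pointwise stabiliser of level `n` permutes the children of each vertex of that level. -/
noncomputable def levelPermHom [NeZero d] (n : ℕ) :
    (T.portraitHom n).ker →* (T.Level n → Equiv.Perm (Fin d)) where
  toFun g x := T.perm g.1 x.1
  map_one' := by
    funext x
    refine Equiv.ext fun i => ?_
    have := T.smul_child (1 : G) x.1 i
    rw [one_smul, one_smul] at this
    exact (T.child_inj this).2.symm
  map_mul' g h := by
    funext x
    obtain ⟨i, hx⟩ := x.2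
    have := (T.mem_ker_portraitHom h.1 n).1 h.2 i _ hx
    simp only [Subgroup.coe_mul, perm_mul, this, Pi.mul_apply]

theorem ker_levelPermHom [NeZero d] (n : ℕ) : (T.levelPermHom n).ker =
    (T.portraitHom (n + 1)).ker.subgroupOf (T.portraitHom n).ker := by
  ext g
  have hg := fun i z => (T.mem_ker_portraitHom g.1 n).1 g.2 i z
  rw [Subgroup.mem_subgroupOf, mem_ker_portraitHom, MonoidHom.mem_ker]
  constructor
  · rintro h i _ ⟨y, hy, a, rfl⟩
    have : T.perm g.1 y = 1 := congrFun h ⟨y, i, hy⟩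
    rw [smul_child, hg i y hy, this]
    rfl
  · intro h
    funext ⟨x, i, hx⟩
    refine Equiv.ext fun a => ?_
    have := h i _ ⟨x, hx, a, rfl⟩
    rw [smul_child] at this
    exact (T.child_inj this).2

theorem ker_portraitHom_succ_le [NeZero d] (n : ℕ) :
    (T.portraitHom (n + 1)).ker ≤ (T.portraitHom n).ker := by
  intro g hg
  rw [mem_ker_portraitHom] at hg ⊢
  intro i z hz
  have := hg i _ ⟨z, hz, 0, rfl⟩
  rw [smul_child] at this
  exact (T.child_inj this).1

/-- The successive kernels have the largest conceivable relative indices, a power of `d!` with one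
factor for each vertex of the level, so the order of the image equals the order of the whole target.
-/
theorem portraitHom_surjective_of_levelPermHom [NeZero d] [Finite ι]
    (h : ∀ n, Function.Surjective (T.levelPermHom n)) (n : ℕ) :
    Function.Surjective (T.portraitHom n) := by
  have index : ∀ n, (T.portraitHom n).ker.index =
      (d.factorial ^ ∑ i ∈ Finset.range n, d ^ i) ^ Nat.card ι := by
    intro n
    induction n with
    | zero =>
      rw [Finset.range_zero, Finset.sum_empty, pow_zero, one_pow, Subgroup.index_eq_one, eq_top_iff]
      rintro g -
      rw [mem_ker_portraitHom]
      rintro i z (rfl : z = _)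
      exact T.smul_root g i
    | succ n ih =>
      have := T.finite_level n
      rw [← Subgroup.relIndex_mul_index (T.ker_portraitHom_succ_le n), ih, Subgroup.relIndex,
        ← ker_levelPermHom, Subgroup.index_ker, MonoidHom.range_eq_top.2 (h n), Subgroup.card_top,
        Nat.card_fun, Nat.card_perm, Nat.card_fin, card_level, Finset.sum_range_succ, pow_add,
        mul_pow, mul_comm, ← pow_mul _ (d ^ n), mul_comm (d ^ n)]
  have h1 := index n
  rw [Subgroup.index_ker] at h1
  rw [← MonoidHom.range_eq_top]
  refine Subgroup.eq_top_of_card_eq _ ?_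
  rw [h1, Nat.card_fun, card_iteratedWreath]

/-! ### Generating the wreath products from sibling swaps and transitivity. -/

section Generation

/-- Some element of `G` induces on level `n + 1` a transposition of two siblings. -/
def HasSiblingSwap (n : ℕ) (i : ι) : Prop :=
  ∃ x ∈ T.level i n, ∃ a b, a ≠ b ∧ ∃ g : G, g • T.child x a = T.child x b ∧
    g • T.child x b = T.child x a ∧ ∀ j, ∀ z ∈ T.level j (n + 1),
      z ≠ T.child x a → z ≠ T.child x b → g • z = z

/-- The group `G` is transitive on the children of some vertex of level `n`. -/
def ChildrenTransitive (n : ℕ) (i : ι) : Prop :=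
  ∃ x ∈ T.level i n, ∀ a b, ∃ g : G, g • T.child x a = T.child x b

/-- The stabiliser of some vertex of level `n + 1` is transitive on its siblings. -/
def SiblingsTransitive (n : ℕ) (i : ι) : Prop :=
  ∃ x ∈ T.level i n, ∃ c, ∀ a b, a ≠ c → b ≠ c → ∃ g : G, g • T.child x c = T.child x c ∧
    g • T.child x a = T.child x b

variable {T}

/-- By induction both parents can be moved to the one vertex whose children are known to be permuted
transitively, so one such vertex per level suffices. -/
theorem exists_smul_eq_of_mem_level {i : ι} (h : ∀ n, T.ChildrenTransitive n i) {n : ℕ} {x y : S}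
    (hx : x ∈ T.level i n) (hy : y ∈ T.level i n) : ∃ g : G, g • x = y := by
  induction n generalizing x y with
  | zero =>
    obtain rfl : x = _ := hx
    obtain rfl : y = _ := hy
    exact ⟨1, one_smul _ _⟩
  | succ n ih =>
    obtain ⟨x, hx, a, rfl⟩ := hx
    obtain ⟨y, hy, b, rfl⟩ := hy
    obtain ⟨z, hz, hzt⟩ := h n
    obtain ⟨g, rfl⟩ := ih hx hz
    obtain ⟨k, hk⟩ := ih hy hz
    obtain ⟨l, hl⟩ := hzt (T.perm g x a) (T.perm k y b)
    refine ⟨k⁻¹ * l * g, ?_⟩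
    rw [mul_smul, smul_child, mul_smul, hl, ← hk, ← smul_child, inv_smul_smul]

/-- Transitivity on level `n + 1` brings the first member of each pair to the distinguished child
`c`; the stabiliser of `c` then matches the second members. -/
theorem exists_smul_pair {i : ι} (h : ∀ n, T.ChildrenTransitive n i)
    {n : ℕ} (h' : T.SiblingsTransitive n i) {x y : S} (hx : x ∈ T.level i n)
    (hy : y ∈ T.level i n) {a b a' b' : Fin d} (hab : a ≠ b) (hab' : a' ≠ b') :
    ∃ g : G, g • T.child x a = T.child y a' ∧ g • T.child x b = T.child y b' := by
  obtain ⟨z, hz, c, hc⟩ := h'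
  have key : ∀ {x a b}, x ∈ T.level i n → a ≠ b →
      ∃ g : G, ∃ e, e ≠ c ∧ g • T.child x a = T.child z c ∧ g • T.child x b = T.child z e := by
    intro x a b hx hab
    obtain ⟨g, hg⟩ := exists_smul_eq_of_mem_level h (n := n + 1) (x := T.child x a)
      (y := T.child z c) ⟨x, hx, a, rfl⟩ ⟨z, hz, c, rfl⟩
    have hg' := hg
    rw [smul_child] at hg'
    obtain ⟨rfl, hgc⟩ := T.child_inj hg'
    refine ⟨g, T.perm g x b, fun he => hab ?_, hg, T.smul_child g x b⟩
    exact (T.perm g x).injective (hgc.trans he.symm)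
  obtain ⟨g, e, he, hg1, hg2⟩ := key hx hab
  obtain ⟨k, f, hf, hk1, hk2⟩ := key hy hab'
  obtain ⟨l, hl1, hl2⟩ := hc e f he hf
  refine ⟨k⁻¹ * l * g, ?_, ?_⟩
  · rw [mul_smul, hg1, mul_smul, hl1, ← hk1, inv_smul_smul]
  · rw [mul_smul, hg2, mul_smul, hl2, ← hk2, inv_smul_smul]

/-- Conjugating the given swap yields every transposition at every vertex. As it fixes everything
else on level `n + 1`, in the other trees too, its image is supported at a single coordinate, and
such elements generate the product. -/
theorem levelPermHom_surjective [NeZero d] [Finite ι] (h : ∀ n i, T.ChildrenTransitive n i)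
    {n : ℕ} (h' : ∀ i, T.SiblingsTransitive n i) (h'' : ∀ i, T.HasSiblingSwap n i) :
    Function.Surjective (T.levelPermHom n) := by
  classical
  have swap : ∀ (x : T.Level n) (a b : Fin d), a ≠ b →
      Pi.mulSingle x (Equiv.swap a b) ∈ (T.levelPermHom n).range := by
    rintro ⟨x, i, hx⟩ a b hab
    obtain ⟨y, hy, a', b', hab', g, hg1, hg2, hg3⟩ := h'' i
    obtain ⟨k, hk1, hk2⟩ := exists_smul_pair (fun n => h n i) (h' i) hy hx hab' hab
    set l : G := k * g * k⁻¹ with hl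
    have l1 : l • T.child x a = T.child x b := by
      rw [hl, ← hk1, mul_smul, inv_smul_smul, mul_smul, hg1, hk2]
    have l2 : l • T.child x b = T.child x a := by
      rw [hl, ← hk2, mul_smul, inv_smul_smul, mul_smul, hg2, hk1]
    have l3 : ∀ j, ∀ z ∈ T.level j (n + 1), z ≠ T.child x a → z ≠ T.child x b → l • z = z := by
      intro j z hz hza hzb
      have hz' : z = k • (k⁻¹ • z) := (smul_inv_smul _ _).symm
      rw [hl, mul_smul, mul_smul, hg3 j _ (T.smul_mem_level k⁻¹ hz), ← hz']
      · rw [← hk1] at hza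
        exact fun e => hza (by rw [hz', e])
      · rw [← hk2] at hzb
        exact fun e => hzb (by rw [hz', e])
    have hlx : l • x = x := by
      rw [smul_child] at l1
      exact (T.child_inj l1).1
    have hlz : ∀ j, ∀ z ∈ T.level j n, z ≠ x → ∀ c, l • T.child z c = T.child z c :=
      fun j z hz hzx c => l3 j _ ⟨z, hz, c, rfl⟩ (fun e => hzx (T.child_inj e).1)
        (fun e => hzx (T.child_inj e).1)
    have hmem : l ∈ (T.portraitHom n).ker := by
      rw [mem_ker_portraitHom]
      intro j z hz
      by_cases hzx : z = x
      · rw [hzx, hlx]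
      · have := hlz j z hz hzx 0
        rw [smul_child] at this
        exact (T.child_inj this).1
    refine ⟨⟨l, hmem⟩, ?_⟩
    funext ⟨z, j, hz⟩
    change T.perm l z = _
    by_cases hzx : z = x
    · subst hzx
      rw [Pi.mulSingle_eq_same]
      refine Equiv.ext fun c => ?_
      have hc : l • T.child z c = T.child z (Equiv.swap a b c) := by
        by_cases hca : c = a
        · rw [hca, l1, Equiv.swap_apply_left]
        by_cases hcb : c = b
        · rw [hcb, l2, Equiv.swap_apply_right]
        rw [Equiv.swap_apply_of_ne_of_ne hca hcb]
        exact l3 j _ ⟨z, hz, c, rfl⟩ (fun e => hca (T.child_inj e).2)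
          (fun e => hcb (T.child_inj e).2)
      rw [smul_child] at hc
      exact (T.child_inj hc).2
    · rw [Pi.mulSingle_eq_of_ne (fun e => hzx (Subtype.ext_iff.1 e))]
      refine Equiv.ext fun c => ?_
      have := hlz j z hz hzx c
      rw [smul_child] at this
      exact (T.child_inj this).2
  have := T.finite_level n
  rw [← MonoidHom.range_eq_top, eq_top_iff]
  rintro p -
  refine Submonoid.pi_mem_of_mulSingle_mem p fun x => ?_
  have hle : (⊤ : Subgroup (Equiv.Perm (Fin d))) ≤ (T.levelPermHom n).range.comap
      (MonoidHom.mulSingle (fun _ : T.Level n => Equiv.Perm (Fin d)) x) := by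
    rw [← Equiv.Perm.closure_isSwap, Subgroup.closure_le]
    rintro _ ⟨a, b, hab, rfl⟩
    exact swap x a b hab
  exact hle (Subgroup.mem_top (p x))

theorem portraitHom_surjective [NeZero d] [Finite ι] (h : ∀ n i, T.ChildrenTransitive n i)
    (h' : ∀ n i, T.SiblingsTransitive n i) (h'' : ∀ n i, T.HasSiblingSwap n i) (n : ℕ) :
    Function.Surjective (T.portraitHom n) :=
  T.portraitHom_surjective_of_levelPermHom (fun n => levelPermHom_surjective h (h' n) (h'' n)) n

end Generation

end RegularForest

/-! ### The monic polynomial with prescribed critical points -/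

section CritPoly

variable {R R' : Type*} [CommRing R] [Algebra ℚ R] [CommRing R'] [Algebra ℚ R'] {r : ℕ}

/-- The polynomial without constant term and with derivative `(r + 1) ∏ (x - γ j)`. -/
noncomputable def critPoly (γ : Fin r → R) : R[X] :=
  ∑ k ∈ Finset.range (r + 1),
    C (algebraMap ℚ R ((r + 1) / (k + 1)) * (∏ j, (X - C (γ j))).coeff k) * X ^ (k + 1)

theorem critPoly_map (φ : R →+* R') (γ : Fin r → R) :
    (critPoly γ).map φ = critPoly (φ ∘ γ) := by
  have h : ((∏ j, (X - C (γ j))).map φ) = ∏ j, (X - C ((φ ∘ γ) j)) := by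
    simp [Polynomial.map_prod]
  simp only [critPoly, Polynomial.map_sum, Polynomial.map_mul, map_C, Polynomial.map_pow, map_X,
    ← h, coeff_map]
  refine Finset.sum_congr rfl fun k _ => ?_
  rw [map_mul, RingHom.map_rat_algebraMap]

theorem natDegree_prod_X_sub_C {R : Type*} [CommRing R] [Nontrivial R] (γ : Fin r → R) :
    (∏ j, (X - C (γ j))).natDegree = r := by
  simp

theorem derivative_critPoly (γ : Fin r → R) :
    derivative (critPoly γ) = C ((r : R) + 1) * ∏ j, (X - C (γ j)) := by
  nontriviality R
  have h : ∏ j, (X - C (γ j)) =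
      ∑ k ∈ Finset.range (r + 1), C ((∏ j, (X - C (γ j))).coeff k) * X ^ k := by
    conv_lhs => rw [as_sum_range_C_mul_X_pow (∏ j, (X - C (γ j))), natDegree_prod_X_sub_C]
  conv_rhs => rw [h, Finset.mul_sum]
  simp only [critPoly, derivative_sum, derivative_C_mul_X_pow, Nat.add_sub_cancel, ← mul_assoc,
    ← C_mul]
  refine Finset.sum_congr rfl fun k _ => ?_
  congr 2
  rw [mul_right_comm]
  congr 1
  have : ((k + 1 : ℕ) : R) = algebraMap ℚ R (k + 1) := by simp
  rw [this, ← map_mul, div_mul_cancel₀ _ (by positivity)]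
  simp

theorem critPoly_monic (γ : Fin r → R) : (critPoly γ).Monic := by
  nontriviality R
  have hm : (∏ j, (X - C (γ j))).coeff r = 1 := by
    have := monic_prod_X_sub_C γ Finset.univ
    rwa [Monic, leadingCoeff, natDegree_prod_X_sub_C] at this
  rw [critPoly, Finset.sum_range_succ, hm, div_self (by positivity), map_one, one_mul, C_1, one_mul,
    add_comm]
  refine monic_X_pow_add ?_
  refine (degree_sum_le _ _).trans_lt ?_
  rw [Finset.sup_lt_iff (WithBot.bot_lt_coe _)]
  intro k hk
  refine (degree_C_mul_X_pow_le _ _).trans_lt ?_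
  exact_mod_cast Nat.succ_lt_succ (Finset.mem_range.1 hk)

theorem natDegree_critPoly [Nontrivial R] (γ : Fin r → R) : (critPoly γ).natDegree = r + 1 := by
  have hm : (∏ j, (X - C (γ j))).coeff r = 1 := by
    have := monic_prod_X_sub_C γ Finset.univ
    rwa [Monic, leadingCoeff, natDegree_prod_X_sub_C] at this
  rw [critPoly, Finset.sum_range_succ, hm, div_self (by positivity), map_one, one_mul, C_1, one_mul]
  have h : (∑ k ∈ Finset.range r, C (algebraMap ℚ R ((r + 1) / (k + 1)) *
      (∏ j, (X - C (γ j))).coeff k) * X ^ (k + 1)).degree < (X ^ (r + 1) : R[X]).degree := by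
    refine (degree_sum_le _ _).trans_lt ?_
    rw [degree_X_pow, Finset.sup_lt_iff (WithBot.bot_lt_coe _)]
    intro k hk
    refine (degree_C_mul_X_pow_le _ _).trans_lt ?_
    exact_mod_cast Nat.succ_lt_succ (Finset.mem_range.1 hk)
  rw [natDegree_add_eq_right_of_degree_lt h, natDegree_X_pow]

theorem critPoly_eval_zero (γ : Fin r → R) : (critPoly γ).eval 0 = 0 := by
  simp only [critPoly, eval_finsetSum, eval_mul, eval_pow, eval_X]
  exact Finset.sum_eq_zero fun k _ => by rw [zero_pow k.succ_ne_zero, mul_zero]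

theorem eq_of_derivative_eq {p q : R[X]} (h : derivative p = derivative q)
    (h0 : p.coeff 0 = q.coeff 0) : p = q := by
  ext n
  cases n with
  | zero => exact h0
  | succ n =>
    have h1 := congrArg (fun f => coeff f n) h
    simp only [coeff_derivative] at h1
    have hu : IsUnit ((n : R) + 1) := by
      have : (n : R) + 1 = algebraMap ℚ R (n + 1) := by simp
      rw [this]
      exact (IsUnit.mk0 _ (by positivity)).map _
    exact hu.mul_right_cancel h1

/-- The degenerate model with one critical point away from the origin. It serves twice: with large
`N` for the escape estimate over ℂ, and with `N = 1` for a reduction having exactly one simple root.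
-/
theorem critPoly_update (hr : 1 ≤ r) (i : Fin r) (N : R) :
    critPoly (Function.update (0 : Fin r → R) i (r * N)) =
      X ^ (r + 1) - C ((r + 1) * N) * X ^ r := by
  refine eq_of_derivative_eq ?_ ?_
  · have : ∏ j, (X - C (Function.update (0 : Fin r → R) i (r * N) j)) =
        X ^ (r - 1) * (X - C (r * N)) := by
      rw [← Finset.prod_erase_mul _ _ (Finset.mem_univ i), Function.update_self,
        Finset.prod_congr rfl (g := fun _ => X), Finset.prod_const,
        Finset.card_erase_of_mem (Finset.mem_univ i), Finset.card_univ, Fintype.card_fin]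
      intro j hj
      rw [Function.update_of_ne (Finset.ne_of_mem_erase hj)]
      simp
    obtain ⟨m, rfl⟩ : ∃ m, r = m + 1 := ⟨r - 1, by omega⟩
    rw [derivative_critPoly, this]
    simp only [derivative_sub, derivative_X_pow, derivative_C_mul_X_pow, Nat.add_sub_cancel]
    push_cast
    simp only [C_mul, C_add, C_1, map_natCast]
    ring
  · rw [coeff_zero_eq_eval_zero, critPoly_eval_zero]
    simp [coeff_zero_eq_eval_zero, show r ≠ 0 by omega]

theorem critPoly_zero : critPoly (0 : Fin r → R) = X ^ (r + 1) := by
  refine eq_of_derivative_eq ?_ ?_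
  · rw [derivative_critPoly]
    simp
  · rw [coeff_zero_eq_eval_zero, critPoly_eval_zero]
    simp

/-- A critical point at the origin makes the origin a double zero of `critPoly`. -/
theorem X_sq_dvd_critPoly {γ : Fin r → R} {i : Fin r} (hi : γ i = 0) :
    X ^ 2 ∣ critPoly γ := by
  rw [X_pow_dvd_iff]
  intro n hn
  have hder : (derivative (critPoly γ)).eval 0 = 0 := by
    rw [derivative_critPoly, eval_mul, eval_prod,
      Finset.prod_eq_zero (Finset.mem_univ i) (by simp [hi]), mul_zero]
  interval_cases n
  · rw [coeff_zero_eq_eval_zero, critPoly_eval_zero]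
  · rw [← coeff_zero_eq_eval_zero, coeff_derivative] at hder
    simpa using hder

/-- The `n`-th iterate of `x ↦ critPoly γ x + t`. -/
noncomputable def critIter (γ : Fin r → R) (t : R) (n : ℕ) (x : R) : R :=
  (fun y => (critPoly γ).eval y + t)^[n] x

@[simp]
theorem critIter_zero (γ : Fin r → R) (t x : R) : critIter γ t 0 x = x := rfl

theorem critIter_succ (γ : Fin r → R) (t : R) (n : ℕ) (x : R) :
    critIter γ t (n + 1) x = critIter γ t n ((critPoly γ).eval x + t) := rfl

theorem critIter_succ' (γ : Fin r → R) (t : R) (n : ℕ) (x : R) :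
    critIter γ t (n + 1) x = (critPoly γ).eval (critIter γ t n x) + t :=
  Function.iterate_succ_apply' _ _ _

theorem critIter_add (γ : Fin r → R) (t : R) (m n : ℕ) (x : R) :
    critIter γ t (m + n) x = critIter γ t m (critIter γ t n x) :=
  Function.iterate_add_apply _ _ _ _

theorem map_critIter (φ : R →+* R') (γ : Fin r → R) (t : R) (n : ℕ) (x : R) :
    φ (critIter γ t n x) = critIter (φ ∘ γ) (φ t) n (φ x) := by
  induction n with
  | zero => rfl
  | succ n ih =>
    rw [critIter_succ', critIter_succ', map_add, ← ih, ← critPoly_map, eval_map, eval₂_hom]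

/-- Evaluating the iterate of the family in the variable `t` at a value of `t`. -/
theorem eval_critIter (γ : Fin r → R) (t : R) (n : ℕ) (p : R[X]) :
    (critIter (C ∘ γ) X n p).eval t = critIter γ t n (p.eval t) := by
  have := map_critIter (evalRingHom t) (C ∘ γ) X n p
  simpa [Function.comp_def] using this

theorem map_critIter_poly (φ : R →+* R') (γ : Fin r → R) (n : ℕ) (p : R[X]) :
    (critIter (C ∘ γ) X n p).map φ = critIter (C ∘ φ ∘ γ) X n (p.map φ) := by
  have := map_critIter (mapRingHom φ) (C ∘ γ) X n p
  simpa [Function.comp_def] using this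

theorem eval_critPoly_C_comp (γ : Fin r → R) (p : R[X]) :
    (critPoly (C ∘ γ)).eval p = (critPoly γ).comp p := by
  rw [← critPoly_map, eval_map, comp]

theorem critIter_poly_monic [Nontrivial R] (hr : 1 ≤ r) (γ : Fin r → R) {p : R[X]}
    (hp : p.Monic) (hp' : p.natDegree = 1) (n : ℕ) :
    (critIter (C ∘ γ) X n p).Monic ∧ (critIter (C ∘ γ) X n p).natDegree = (r + 1) ^ n := by
  induction n with
  | zero => exact ⟨hp, hp'⟩
  | succ n ih =>
    rw [critIter_succ', eval_critPoly_C_comp]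
    have hq : ((critPoly γ).comp (critIter (C ∘ γ) X n p)).Monic :=
      (critPoly_monic γ).comp ih.1 (by rw [ih.2]; positivity)
    have hd : ((critPoly γ).comp (critIter (C ∘ γ) X n p)).natDegree = (r + 1) ^ (n + 1) := by
      rw [natDegree_comp_eq_of_mul_ne_zero, natDegree_critPoly, ih.2, pow_succ']
      rw [(critPoly_monic γ).leadingCoeff, ih.1.leadingCoeff]
      simp
    have hlt : (X : R[X]).natDegree <
        ((critPoly γ).comp (critIter (C ∘ γ) X n p)).natDegree := by
      rw [hd, natDegree_X]
      exact Nat.one_lt_pow (by omega) (by omega)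
    exact ⟨hq.add_of_left (degree_lt_degree hlt), by
      rw [natDegree_add_eq_left_of_natDegree_lt hlt, hd]⟩

/-- The relation `f_T ^ (n + 1) (a) = b` as a polynomial in the variable `T`. -/
noncomputable def relPoly (γ : Fin r → R) (n : ℕ) (a b : R) : R[X] :=
  critIter (C ∘ γ) X (n + 1) (C a) - C b

theorem eval_relPoly (γ : Fin r → R) (n : ℕ) (a b t : R) :
    (relPoly γ n a b).eval t = critIter γ t (n + 1) a - b := by
  rw [relPoly, eval_sub, eval_critIter, eval_C, eval_C]

theorem map_relPoly (φ : R →+* R') (γ : Fin r → R) (n : ℕ) (a b : R) :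
    (relPoly γ n a b).map φ = relPoly (φ ∘ γ) n (φ a) (φ b) := by
  rw [relPoly, Polynomial.map_sub, map_critIter_poly, map_C, map_C, relPoly]

/-- The first iterate of a constant is already linear and monic in the parameter, and each of the
remaining `n` iterations multiplies the degree by `r + 1`. -/
theorem relPoly_monic [Nontrivial R] (hr : 1 ≤ r) (γ : Fin r → R) (n : ℕ) (a b : R) :
    (relPoly γ n a b).Monic ∧ (relPoly γ n a b).natDegree = (r + 1) ^ n := by
  have h1 : (critPoly (C ∘ γ)).eval (C a) + X = X + C ((critPoly γ).eval a) := by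
    rw [eval_critPoly_C_comp, comp_C, add_comm]
  have h := critIter_poly_monic hr γ (monic_X_add_C ((critPoly γ).eval a)) (natDegree_X_add_C _) n
  rw [← h1, ← critIter_succ] at h
  have hlt : (C b).natDegree < (critIter (C ∘ γ) X (n + 1) (C a)).natDegree := by
    rw [natDegree_C, h.2]
    positivity
  exact ⟨h.1.sub_of_left (degree_lt_degree hlt), by
    rw [relPoly, natDegree_sub_eq_left_of_natDegree_lt hlt, h.2]⟩

end CritPoly

/-! ### Specialisation and algebraic independence -/

/-- Coprimality of a monic polynomial with another one can be checked after specialisation. -/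
theorem isCoprime_map_of_isCoprime_map {A k₁ k₂ : Type*} [CommRing A] [Field k₁] [Field k₂]
    {P Q : A[X]} (hP : P.Monic) (φ : A →+* k₁) (θ : A →+* k₂) (hθ : Function.Injective θ)
    (h : IsCoprime (P.map φ) (Q.map φ)) : IsCoprime (P.map θ) (Q.map θ) := by
  have h1 : IsUnit (resultant (P.map φ) (Q.map φ) (P.map φ).natDegree Q.natDegree) := by
    have := (isUnit_resultant_iff_isCoprime (hP.map φ)).2 h
    -- The degree of `Q` may drop under `φ`. Raising its formal degree multiplies the resultant by a
    -- power of the leading coefficient of `P`, which is 1, so the resultant can be computed in `A`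
    -- and then mapped.
    have h2 := resultant_add_right_deg (f := P.map φ) (g := Q.map φ) (m := (P.map φ).natDegree)
      (n := (Q.map φ).natDegree) (Q.natDegree - (Q.map φ).natDegree) le_rfl
    rw [Nat.add_sub_cancel' natDegree_map_le, coeff_natDegree, (hP.map φ).leadingCoeff] at h2
    rw [h2]
    simpa using this
  rw [hP.natDegree_map, resultant_map_map] at h1
  have h3 : resultant P Q ≠ 0 := by
    intro h0
    rw [h0, map_zero] at h1
    exact not_isUnit_zero h1
  rw [← isUnit_resultant_iff_isCoprime (hP.map θ), isUnit_iff_ne_zero, hP.natDegree_map,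
    natDegree_map_eq_of_injective hθ, resultant_map_map]
  exact (map_ne_zero_iff θ hθ).2 h3

open scoped IntermediateField.algebraAdjoinAdjoin in
/-- A finite family over which as many algebraically independent elements are algebraic is itself
algebraically independent. -/
theorem AlgebraicIndependent.of_isAlgebraic_adjoin {K L ι : Type*} [Field K] [Field L] [Algebra K L]
    [Finite ι] {x y : ι → L} (hy : AlgebraicIndependent K y)
    (h : ∀ i, IsAlgebraic (IntermediateField.adjoin K (Set.range x)) (y i)) :
    AlgebraicIndependent K x := by
  -- Rank count in the matroid of algebraic independence: `y` is independent and lies in the closure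
  -- of `x`, so `x` has rank at least the size of the index set. Hence `range x` is its own basis
  -- and `x` has no repetitions.
  have hsub : Set.range y ⊆ (matroid K L).closure (Set.range x) := by
    rintro _ ⟨i, rfl⟩
    rw [matroid_closure_eq, SetLike.mem_coe, Subalgebra.mem_algebraicClosure]
    exact (IsFractionRing.isAlgebraic_iff _ (IntermediateField.adjoin K (Set.range x)) _).2 (h i)
  have hle : (Set.range y).encard ≤ (matroid K L).eRk (Set.range x) := by
    rw [← Matroid.eRk_closure_eq]
    exact (matroid_indep_iff.2 hy.to_subtype_range).encard_le_eRk_of_subset hsub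
  have hcard : (Set.range y).encard = ENat.card ι := by
    rw [← Set.image_univ, hy.injective.encard_image, Set.encard_univ]
  have hx : (Set.range x).encard ≤ ENat.card ι := by
    rw [← Set.image_univ, ← Set.encard_univ]
    exact Set.encard_image_le _ _
  obtain ⟨I, hI⟩ := (matroid K L).exists_isBasis (Set.range x)
  rw [hcard, hI.eRk_eq_encard] at hle
  have hfin := Set.finite_range x
  have hIx : I = Set.range x :=
    (hfin.subset hI.subset).eq_of_subset_of_encard_le hI.subset (hx.trans hle)
  rw [hIx] at hle
  rw [hIx] at hI
  refine AlgebraicIndependent.of_subtype_range ?_ hI.indep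
  have hc : Nat.card ι ≤ Nat.card (Set.range x) := by
    rw [ENat.card_eq_coe_natCard, ← hfin.cast_ncard_eq] at hle
    exact_mod_cast hle
  have := Set.rangeFactorization_surjective (f := x) |>.bijective_of_nat_card_le hc
  exact fun a b hab => this.1 (Subtype.ext hab)

/-- A field generated by an algebraically independent family maps to any field containing an
algebraically independent family with the same index set. -/
theorem AlgebraicIndependent.exists_algHom {K B M ι : Type*} [Field K] [Field B] [Field M]
    [Algebra K B] [Algebra K M] {x : ι → B} {y : ι → M} (hx : AlgebraicIndependent K x)
    (hgen : IntermediateField.adjoin K (Set.range x) = ⊤) (hy : AlgebraicIndependent K y) :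
    ∃ ψ : B →ₐ[K] M, ∀ i, ψ (x i) = y i := by
  let e := (IntermediateField.equivOfEq hgen).trans IntermediateField.topEquiv
  refine ⟨((IntermediateField.val _).comp
    (hx.aevalEquivField.symm.trans hy.aevalEquivField).toAlgHom).comp e.symm.toAlgHom, fun i => ?_⟩
  have hi : x i ∈ IntermediateField.adjoin K (Set.range x) :=
    IntermediateField.subset_adjoin _ _ ⟨i, rfl⟩
  have h1 : e.symm (x i) = ⟨x i, hi⟩ := by
    rw [AlgEquiv.symm_apply_eq]
    rfl
  have h2 : hx.aevalEquivField.symm ⟨x i, hi⟩ =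
      algebraMap (MvPolynomial ι K) _ (MvPolynomial.X i) := by
    rw [AlgEquiv.symm_apply_eq]
    apply Subtype.ext
    rw [aevalEquivField_algebraMap_apply_coe, MvPolynomial.aeval_X]
  change ((hy.aevalEquivField (hx.aevalEquivField.symm (e.symm (x i))) :
    IntermediateField.adjoin K (Set.range y)) : M) = y i
  rw [h1, h2, aevalEquivField_algebraMap_apply_coe, MvPolynomial.aeval_X]

/-! ### Parameters with a single critical relation -/

section Param

variable {r : ℕ}

/-- The polynomials `0, T, T ^ d + T, …` over the integers. -/
noncomputable def gleasonPoly (d : ℕ) : ℕ → ℤ[X]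
  | 0 => X
  | n + 1 => gleasonPoly d n ^ d + X

theorem relPoly_zero_eq_map_gleasonPoly (n : ℕ) :
    relPoly (0 : Fin r → ℚ) n 0 0 = (gleasonPoly (r + 1) n).map (Int.castRingHom ℚ) := by
  have h0 : (C ∘ (0 : Fin r → ℚ)) = 0 := by
    funext i
    simp
  rw [relPoly, C_0, sub_zero, h0]
  induction n with
  | zero => simp [critIter_succ', critPoly_zero, gleasonPoly]
  | succ n ih =>
    rw [critIter_succ', ih, critPoly_zero]
    simp [gleasonPoly]

theorem gleasonPoly_monic {d : ℕ} (hd : 2 ≤ d) (n : ℕ) : (gleasonPoly d n).Monic := by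
  suffices h : (gleasonPoly d n).Monic ∧ 1 ≤ (gleasonPoly d n).natDegree from h.1
  induction n with
  | zero => exact ⟨monic_X, natDegree_X.ge⟩
  | succ n ih =>
    have hd' : (gleasonPoly d n ^ d).natDegree = d * (gleasonPoly d n).natDegree :=
      ih.1.natDegree_pow d
    have hlt : (X : ℤ[X]).natDegree < (gleasonPoly d n ^ d).natDegree := by
      rw [hd', natDegree_X]
      nlinarith
    refine ⟨(ih.1.pow d).add_of_left (degree_lt_degree hlt), ?_⟩
    rw [gleasonPoly, natDegree_add_eq_left_of_natDegree_lt hlt, hd']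
    nlinarith

/-- Modulo a prime dividing the exponent `r + 1`, the derivative of a Gleason polynomial is 1,
because the derivative of the power vanishes. -/
theorem isCoprime_relPoly_zero (hr : 1 ≤ r) (n : ℕ) :
    IsCoprime (relPoly (0 : Fin r → ℚ) n 0 0) (derivative (relPoly (0 : Fin r → ℚ) n 0 0)) := by
  rw [relPoly_zero_eq_map_gleasonPoly, derivative_map]
  have hp : Fact (r + 1).minFac.Prime := ⟨Nat.minFac_prime (by omega)⟩
  refine isCoprime_map_of_isCoprime_map (gleasonPoly_monic (by omega) n)
    (Int.castRingHom (ZMod (r + 1).minFac)) _ Int.cast_injective ?_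
  have h : (derivative (gleasonPoly (r + 1) n)).map (Int.castRingHom (ZMod (r + 1).minFac)) = 1 := by
    have hz : ((r + 1 : ℕ) : ZMod (r + 1).minFac) = 0 :=
      (ZMod.natCast_eq_zero_iff _ _).2 (Nat.minFac_dvd _)
    cases n with
    | zero => simp [gleasonPoly]
    | succ n =>
      rw [gleasonPoly, derivative_add, derivative_pow, derivative_X, Polynomial.map_add,
        Polynomial.map_mul, Polynomial.map_mul, Polynomial.map_one, map_C, eq_intCast,
        Int.cast_natCast, hz, C_0, zero_mul, zero_mul, zero_add]
  rw [h]
  exact isCoprime_one_right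

variable {k : Type*} [Field k] [Algebra ℚ k] {c : Fin r → k}

theorem relPoly_eq_map_aeval (n : ℕ) (i j : Fin r) :
    relPoly c n (c i) (c j) = (relPoly (MvPolynomial.X : Fin r → MvPolynomial (Fin r) ℚ) n
      (MvPolynomial.X i) (MvPolynomial.X j)).map (MvPolynomial.aeval c).toRingHom := by
  rw [map_relPoly]
  congr 1
  · funext i
    simp
  · simp
  · simp

/-- Separability may be tested after moving all critical points to 0, where the relation becomes a
Gleason polynomial. -/
theorem isCoprime_relPoly_derivative (hr : 1 ≤ r) (hc : AlgebraicIndependent ℚ c) (n : ℕ)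
    (j : Fin r) :
    IsCoprime (relPoly c n (c j) (c j)) (derivative (relPoly c n (c j) (c j))) := by
  rw [relPoly_eq_map_aeval, derivative_map]
  refine isCoprime_map_of_isCoprime_map (relPoly_monic hr _ _ _ _).1
    (MvPolynomial.aeval (0 : Fin r → ℚ)).toRingHom _ hc ?_
  rw [← derivative_map, map_relPoly]
  have h0 : (MvPolynomial.aeval (R := ℚ) (0 : Fin r → ℚ)).toRingHom ∘ MvPolynomial.X = 0 := by
    funext i
    simp
  have h1 : (MvPolynomial.aeval (R := ℚ) (0 : Fin r → ℚ)).toRingHom (MvPolynomial.X j) = 0 := by simp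
  rw [h0, h1]
  exact isCoprime_relPoly_zero hr n

/-- For two far apart critical points, their orbits cannot both return to critical points. -/
theorem not_both_critical_relations (hr : 1 ≤ r) (τ : ℂ) {i j : Fin r} (hij : i ≠ j)
    {γ : Fin r → ℂ} (hγ : γ = Function.update (0 : Fin r → ℂ) i (r * (4 * (r + 1)))) (m n : ℕ) (l l' : Fin r)
    (h : critIter γ τ (n + 1) (γ j) = γ l) : critIter γ τ (m + 1) (γ i) ≠ γ l' := by
  -- The map is `x ^ r * (x - D * N) + τ`. If `‖x‖ ≥ 2 * D * N` and `‖x‖ ≥ ‖τ‖`, then `‖x - D * N‖ ≥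
  -- 2`, so the image has norm at least `2‖x‖ - ‖τ‖ ≥ ‖x‖`: orbits never come back below this
  -- radius, while all critical points lie below it.
  set D : ℝ := r + 1 with hD
  set N : ℝ := 4 * D with hN
  have hr1 : (1 : ℝ) ≤ r := by exact_mod_cast hr
  have hDN : 8 ≤ 2 * D * N := by nlinarith
  have hN' : (4 * ((r : ℂ) + 1)) = (N : ℂ) := by simp [hN, hD]
  have hpoly : ∀ x, (critPoly γ).eval x + τ = x ^ r * (x - D * N) + τ := by
    intro x
    rw [hγ, critPoly_update hr, hN']
    simp only [eval_sub, eval_pow, eval_X, eval_mul, eval_C, hD]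
    push_cast
    ring
  have hsmall : ∀ l, ‖γ l‖ < 2 * D * N := by
    intro l
    rw [hγ, hN']
    by_cases hl : l = i
    · rw [hl, Function.update_self, norm_mul, Complex.norm_natCast, Complex.norm_real,
        Real.norm_of_nonneg (by positivity)]
      nlinarith
    · rw [Function.update_of_ne hl]
      simp only [Pi.zero_apply, norm_zero]
      positivity
  have escape : ∀ x : ℂ, 2 * D * N ≤ ‖x‖ → ‖τ‖ ≤ ‖x‖ →
      ‖x‖ ≤ ‖(critPoly γ).eval x + τ‖ := by
    intro x hx hτ
    rw [hpoly]
    have h1 : ‖x‖ - D * N ≤ ‖x - D * N‖ := by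
      refine le_trans (le_of_eq ?_) (norm_sub_norm_le _ _)
      rw [norm_mul, Complex.norm_real, Complex.norm_real, Real.norm_of_nonneg (by positivity),
        Real.norm_of_nonneg (by positivity)]
    have h2 : ‖x‖ ≤ ‖x‖ ^ r := le_self_pow₀ (by linarith) (by omega)
    have h3 : ‖x ^ r * (x - D * N)‖ - ‖τ‖ ≤ ‖x ^ r * (x - D * N) + τ‖ := by
      have := norm_sub_norm_le (x ^ r * (x - D * N)) (-τ)
      rwa [norm_neg, sub_neg_eq_add] at this
    rw [norm_mul, norm_pow] at h3
    have h4 : 2 ≤ ‖x - D * N‖ := by linarith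
    have h5 : ‖x‖ * 2 ≤ ‖x‖ ^ r * ‖x - D * N‖ := by gcongr
    linarith
  have escape_iter : ∀ (n : ℕ) (x : ℂ), 2 * D * N ≤ ‖x‖ → ‖τ‖ ≤ ‖x‖ →
      2 * D * N ≤ ‖critIter γ τ n x‖ := by
    intro n
    induction n with
    | zero => exact fun x hx _ => hx
    | succ n ih =>
      intro x hx hτ
      have := escape x hx hτ
      exact ih _ (hx.trans this) (hτ.trans this)
  -- The critical point `γ j` is 0 and its first image is `τ`, which would otherwise have escaped.
  have hτ : ‖τ‖ < 2 * D * N := by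
    by_contra! hτ
    have := escape_iter n τ hτ le_rfl
    have hj : (critPoly γ).eval (γ j) + τ = τ := by
      rw [hpoly, hγ, Function.update_of_ne hij.symm]
      simp [show r ≠ 0 by omega]
    rw [critIter_succ, hj] at h
    rw [h] at this
    exact absurd this (not_le.2 (hsmall l))
  intro h'
  have hi : γ i = ((r * N : ℝ) : ℂ) := by
    rw [hγ, hN', Function.update_self]
    push_cast
    rfl
  -- Since `r - D = -1`, the second factor is `-N`, and the product has norm at least `N * N = 4 * D
  -- * N`. This is where `N = 4 * D` comes from: after subtracting `‖τ‖` the image of `γ i` still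
  -- lies beyond the escape radius.
  have hbig : 4 * D * N ≤ ‖(((r * N : ℝ) : ℂ)) ^ r * ((r * N : ℝ) - D * N)‖ := by
    have e : (((r * N : ℝ) : ℂ) - D * N) = ((-N : ℝ) : ℂ) := by
      push_cast [hD]
      ring
    rw [e, norm_mul, norm_pow, Complex.norm_real, Complex.norm_real, norm_neg,
      Real.norm_of_nonneg (by positivity), Real.norm_of_nonneg (by positivity)]
    have h1 : (r * N : ℝ) ≤ (r * N) ^ r := le_self_pow₀ (by nlinarith) (by omega)
    have h2 : N ≤ (r * N) ^ r := by nlinarith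
    have h3 : N * N ≤ (r * N) ^ r * N := by gcongr
    nlinarith
  have hfirst : 2 * D * N ≤ ‖(critPoly γ).eval (γ i) + τ‖ := by
    rw [hpoly, hi]
    have := norm_sub_norm_le ((((r * N : ℝ) : ℂ)) ^ r * ((r * N : ℝ) - D * N)) (-τ)
    rw [norm_neg, sub_neg_eq_add] at this
    linarith
  have := escape_iter m _ hfirst (hτ.le.trans hfirst)
  rw [← critIter_succ, h'] at this
  exact absurd this (not_le.2 (hsmall l'))

/-- A common root would be a parameter at which two distinct critical points both have critical
points in their forward orbits. The complex specialisation above has no such parameter, and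
coprimality lifts from it. -/
theorem isCoprime_relPoly_of_ne (hr : 1 ≤ r) (hc : AlgebraicIndependent ℚ c) (m n : ℕ)
    {i j : Fin r} (hij : i ≠ j) (l l' : Fin r) :
    IsCoprime (relPoly c n (c j) (c l)) (relPoly c m (c i) (c l')) := by
  rw [relPoly_eq_map_aeval, relPoly_eq_map_aeval]
  set γ : Fin r → ℂ := Function.update (0 : Fin r → ℂ) i (r * (4 * (r + 1))) with hγ
  refine isCoprime_map_of_isCoprime_map (relPoly_monic hr _ _ _ _).1
    (MvPolynomial.aeval γ).toRingHom _ hc ?_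
  rw [← relPoly_eq_map_aeval, ← relPoly_eq_map_aeval,
    isCoprime_iff_aeval_ne_zero_of_isAlgClosed ℂ ℂ]
  intro τ
  rw [or_iff_not_imp_left, not_not]
  simp only [coe_aeval_eq_eval, eval_relPoly, sub_eq_zero, ne_eq]
  exact fun h => not_both_critical_relations hr τ hij hγ m n l l' h

/-- The relation of length `n + 1` has `(r + 1) ^ n` distinct roots, more than the shorter relations
of `c j` with itself can have together; take one that avoids those. Relations starting from another
critical point are excluded by coprimality. -/
theorem exists_unique_critical_relation [IsAlgClosed k] (hr : 1 ≤ r)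
    (hc : AlgebraicIndependent ℚ c) (n : ℕ) (j : Fin r) :
    ∃ τ : k, critIter c τ (n + 1) (c j) = c j ∧
      (derivative (relPoly c n (c j) (c j))).eval τ ≠ 0 ∧
      ∀ m ≤ n, ∀ i l, critIter c τ (m + 1) (c i) = c l → m = n ∧ i = j ∧ l = j := by
  classical
  let P : ℕ → k[X] := fun m => relPoly c m (c j) (c j)
  have hP : ∀ m, (P m).Monic ∧ (P m).natDegree = (r + 1) ^ m := fun m => relPoly_monic hr _ _ _ _
  have hsep : (P n).Separable := isCoprime_relPoly_derivative hr hc n j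
  have hcard : (P n).roots.toFinset.card = (r + 1) ^ n := by
    rw [Multiset.toFinset_card_of_nodup (nodup_roots hsep),
      splits_iff_card_roots.1 (IsAlgClosed.splits _), (hP n).2]
  have hsmall : ((Finset.range n).biUnion fun m => (P m).roots.toFinset).card < (r + 1) ^ n := by
    refine Finset.card_biUnion_le.trans_lt ?_
    refine lt_of_le_of_lt (Finset.sum_le_sum (g := fun m => (r + 1) ^ m) fun m _ => ?_) ?_
    · exact (Multiset.toFinset_card_le _).trans ((card_roots' _).trans (hP m).2.le)
    · exact Nat.geomSum_lt (by omega) fun m hm => Finset.mem_range.1 hm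
  obtain ⟨τ, hτ, hτ'⟩ := Finset.exists_mem_notMem_of_card_lt_card (hsmall.trans_eq hcard.symm)
  rw [Multiset.mem_toFinset, mem_roots (hP n).1.ne_zero, IsRoot, eval_relPoly, sub_eq_zero] at hτ
  have hne : ∀ i l m, i ≠ j → critIter c τ (m + 1) (c i) ≠ c l := by
    intro i l m hij h
    obtain ⟨u, v, huv⟩ := isCoprime_relPoly_of_ne hr hc m n hij j l
    have := congrArg (eval τ) huv
    simp [eval_relPoly, hτ, h] at this
  refine ⟨τ, hτ, fun h0 => ?_, fun m hm i l h => ?_⟩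
  · obtain ⟨u, v, huv⟩ := hsep
    have := congrArg (eval τ) huv
    simp [P, eval_relPoly, hτ, h0] at this
  · obtain rfl : i = j := by
      by_contra hij
      exact hne i l m hij h
    obtain hmn | rfl := hm.lt_or_eq
    · exfalso
      by_cases hl : l = i
      · subst hl
        refine hτ' (Finset.mem_biUnion.2 ⟨m, Finset.mem_range.2 hmn, ?_⟩)
        rw [Multiset.mem_toFinset, mem_roots (hP m).1.ne_zero, IsRoot, eval_relPoly, sub_eq_zero, h]
      -- If the orbit of `c j` met another critical point `c l` on its way, the orbit of `c l` would
      -- reach `c j` in the remaining `n - m` steps.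
      · refine hne l i (n - m - 1) hl ?_
        rw [← h, ← critIter_add, show n - m - 1 + 1 + (m + 1) = n + 1 by omega, hτ]
    · exact ⟨rfl, rfl, hc.injective (h.symm.trans hτ)⟩

end Param

/-! ### Roots over power series rings -/

section Hensel

variable {k : Type*} [Field k]

theorem exists_root_of_simple_root {p : (PowerSeries k)[X]} (hp : p.Monic) {a : k}
    (ha : (p.map PowerSeries.constantCoeff).eval a = 0)
    (ha' : (derivative (p.map PowerSeries.constantCoeff)).eval a ≠ 0) :
    ∃ x : PowerSeries k, p.eval x = 0 ∧ PowerSeries.constantCoeff x = a := by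
  have key : ∀ q : (PowerSeries k)[X], PowerSeries.constantCoeff (q.eval (PowerSeries.C a)) =
      (q.map PowerSeries.constantCoeff).eval a := by
    intro q
    rw [eval_map, ← eval₂_hom, PowerSeries.constantCoeff_C]
  obtain ⟨x, hx, hxa⟩ := HenselianRing.is_henselian (I := Ideal.span {(PowerSeries.X : PowerSeries k)})
    p hp (PowerSeries.C a)
    (by rw [Ideal.mem_span_singleton, PowerSeries.X_dvd_iff, key, ha])
    (by
      refine IsUnit.map _ ?_
      rw [PowerSeries.isUnit_iff_constantCoeff, key, ← derivative_map]
      exact isUnit_iff_ne_zero.2 ha')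
  refine ⟨x, hx, ?_⟩
  rw [Ideal.mem_span_singleton, PowerSeries.X_dvd_iff, map_sub, PowerSeries.constantCoeff_C,
    sub_eq_zero] at hxa
  exact hxa

theorem root_unique_of_simple_root {p : (PowerSeries k)[X]} {x y : PowerSeries k}
    (hx : p.eval x = 0) (hy : p.eval y = 0) (hxy : PowerSeries.constantCoeff x = PowerSeries.constantCoeff y)
    (h : (derivative (p.map PowerSeries.constantCoeff)).eval (PowerSeries.constantCoeff x) ≠ 0) : x = y := by
  obtain ⟨q, hq⟩ := binomExpansion p x (y - x)
  rw [add_sub_cancel, hx, hy, zero_add, pow_two, ← mul_assoc, ← add_mul] at hq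
  rcases mul_eq_zero.1 hq.symm with h0 | h0
  · refine absurd (congrArg PowerSeries.constantCoeff h0) ?_
    rw [map_add, map_mul, map_sub, hxy, sub_self, mul_zero, add_zero, map_zero]
    rwa [derivative_map, eval_map, eval₂_hom] at h
  · exact (sub_eq_zero.1 h0).symm

/-- If the reduction has no multiple root then all roots in an extension are power series. -/
theorem exists_algebraMap_eq_of_separable [IsAlgClosed k] {L : Type*} [Field L]
    [Algebra (PowerSeries k) L] {p : (PowerSeries k)[X]} (hp : p.Monic)
    (hsep : ∀ a, (p.map PowerSeries.constantCoeff).eval a = 0 →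
      (derivative (p.map PowerSeries.constantCoeff)).eval a ≠ 0)
    {y : L} (hy : aeval y p = 0) :
    ∃ x : PowerSeries k, p.eval x = 0 ∧ algebraMap _ L x = y := by
  classical
  set q := p.map PowerSeries.constantCoeff with hq
  have hqm : q.Monic := hp.map _
  have hnodup : q.roots.Nodup := by
    rw [Multiset.nodup_iff_count_le_one]
    intro a
    rw [count_roots]
    by_contra! h
    have hroot := (one_lt_rootMultiplicity_iff_isRoot hqm.ne_zero).1 h
    exact hsep a hroot.1 hroot.2
  have hcard : q.roots.toFinset.card = p.natDegree := by
    rw [Multiset.toFinset_card_of_nodup hnodup, splits_iff_card_roots.1 (IsAlgClosed.splits q),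
      hp.natDegree_map]
  have hlift : ∀ a : q.roots.toFinset, ∃ x : PowerSeries k, p.eval x = 0 ∧ PowerSeries.constantCoeff x = a := by
    rintro ⟨a, ha⟩
    rw [Multiset.mem_toFinset, mem_roots hqm.ne_zero] at ha
    exact exists_root_of_simple_root hp ha (hsep a ha)
  choose l hl hl' using hlift
  have hinj : Function.Injective l := fun a b h => Subtype.ext (by rw [← hl', ← hl', h])
  have hle : p.natDegree ≤ p.roots.toFinset.card := by
    rw [← hcard, ← Fintype.card_coe, ← Finset.card_univ, ← Finset.card_image_of_injective _ hinj]
    refine Finset.card_le_card fun x hx => ?_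
    obtain ⟨a, -, rfl⟩ := Finset.mem_image.1 hx
    rw [Multiset.mem_toFinset, mem_roots hp.ne_zero]
    exact hl a
  have hroots : p.roots.card = p.natDegree :=
    le_antisymm (card_roots' p) (hle.trans (Multiset.toFinset_card_le _))
  rw [← prod_multiset_X_sub_C_of_monic_of_roots_card_eq hp hroots, map_multiset_prod,
    Multiset.map_map, Multiset.prod_eq_zero_iff, Multiset.mem_map] at hy
  obtain ⟨x, hx, hxy⟩ := hy
  refine ⟨x, (mem_roots hp.ne_zero).1 hx, ?_⟩
  simp only [Function.comp_apply, map_sub, aeval_X, aeval_C, sub_eq_zero] at hxy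
  exact hxy.symm

variable {M L : Type*} [Field M] [Algebra (PowerSeries k) M] [IsFractionRing (PowerSeries k) M]
  [Field L] [Algebra M L] [Algebra (PowerSeries k) L] [IsScalarTower (PowerSeries k) M L]

/-- The roots of an Eisenstein polynomial are conjugate. -/
theorem exists_algEquiv_of_eisenstein [Normal M L] {p : (PowerSeries k)[X]} (hp : p.Monic)
    (hdeg : 0 < p.natDegree) (hred : p.map PowerSeries.constantCoeff = X ^ p.natDegree)
    (hconst : PowerSeries.coeff 1 (p.coeff 0) ≠ 0) {u v : L} (hu : aeval u p = 0)
    (hv : aeval v p = 0) : ∃ σ : Gal(L/M), σ u = v := by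
  have hE : p.IsEisensteinAt (Ideal.span {(PowerSeries.X : PowerSeries k)}) := by
    refine ⟨?_, fun {n} hn => ?_, ?_⟩
    · rw [hp.leadingCoeff, Ideal.mem_span_singleton, PowerSeries.X_dvd_iff, map_one]
      exact one_ne_zero
    · rw [Ideal.mem_span_singleton, PowerSeries.X_dvd_iff, ← coeff_map, hred, coeff_X_pow,
        if_neg hn.ne]
    · rw [Ideal.span_singleton_pow, Ideal.mem_span_singleton, PowerSeries.X_pow_dvd_iff]
      exact fun h => hconst (h 1 (by norm_num))
  have hirr := hE.irreducible PowerSeries.span_X_isPrime hp.isPrimitive hdeg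
  rw [hp.irreducible_iff_irreducible_map_fraction_map (K := M)] at hirr
  have hmin : ∀ w : L, aeval w p = 0 → minpoly M w = p.map (algebraMap _ M) := by
    intro w hw
    refine (minpoly.eq_of_irreducible_of_monic hirr ?_ (hp.map _)).symm
    rwa [aeval_map_algebraMap]
  have : IsConjRoot M v u := (hmin v hv).trans (hmin u hu).symm
  exact isConjRoot_iff_exists_algEquiv.1 this

end Hensel

/-! ### Algebraically independent power series -/

section Independence

variable {K k : Type*} [Field K] [Field k] [Algebra K k] {r : ℕ}

theorem transcendental_powerSeries_X : Transcendental k (PowerSeries.X : PowerSeries k) := by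
  rw [transcendental_iff]
  intro p hp
  have h : aeval (PowerSeries.X : PowerSeries k) p = (p : PowerSeries k) := by
    rw [← eval₂_C_X_eq_coe]
    rfl
  rw [h] at hp
  exact coe_injective k (hp.trans coe_zero.symm)

theorem algebraicIndependent_X_C {c : Fin r → k} (hc : AlgebraicIndependent K c) :
    AlgebraicIndependent K (fun o : Option (Fin r) =>
      o.elim (PowerSeries.X : PowerSeries k) (fun j => PowerSeries.C (c j))) := by
  have hX : AlgebraicIndependent k (fun _ : PUnit.{1} => (PowerSeries.X : PowerSeries k)) :=
    (algebraicIndependent_unique_type_iff).2 transcendental_powerSeries_X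
  have h := hc.sumElim_comp hX
  refine (algebraicIndependent_equiv' ((Equiv.optionEquivSumPUnit (Fin r)).trans
    (Equiv.sumComm _ _)) ?_).2 h
  funext o
  cases o <;> rfl

/-- A point whose image under an iterate is algebraic over a field of definition is algebraic. -/
theorem isIntegral_of_isIntegral_critIter {N M : Type*} [Field N] [Field M] [Algebra ℚ M]
    [Algebra N M] {γ : Fin r → M} {t : M} (hγ : ∀ j, IsIntegral N (γ j)) (ht : IsIntegral N t)
    {n : ℕ} {y : M} (hy : IsIntegral N (critIter γ t n y)) : IsIntegral N y := by
  induction n generalizing y with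
  | zero => exact hy
  | succ n ih =>
    rw [critIter_succ] at hy
    replace hy := ih hy
    have : CharZero M := algebraRat.charZero M
    let γ' : Fin r → algebraicClosure N M := fun j => ⟨γ j, mem_algebraicClosure_iff.2 (hγ j).isAlgebraic⟩
    let b : algebraicClosure N M := ⟨_, mem_algebraicClosure_iff.2 (hy.sub ht).isAlgebraic⟩
    have h : IsIntegral (algebraicClosure N M) y := by
      refine ⟨critPoly γ' - C b, ?_, ?_⟩
      · refine (critPoly_monic γ').sub_of_left (degree_lt_degree ?_)
        rw [natDegree_C, natDegree_critPoly]
        omega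
      · rw [eval₂_sub, eval₂_C, ← eval_map, critPoly_map]
        change (critPoly γ).eval y - ((critPoly γ).eval y + t - t) = 0
        ring
    exact isIntegral_trans y h

variable {M : Type*} [Field M] [Algebra (PowerSeries k) M]
  [IsFractionRing (PowerSeries k) M] [Algebra K M] [IsScalarTower K (PowerSeries k) M]

/-- If `c` and the variable are algebraic over a family of power series of the same size then
this family is algebraically independent. -/
theorem algebraicIndependent_of_isIntegral {c : Fin r → k} (hc : AlgebraicIndependent K c)
    (γ : Fin r → M) (t : M)
    (hX : IsIntegral (IntermediateField.adjoin K (Set.range fun o : Option (Fin r) => o.elim t γ))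
      (algebraMap (PowerSeries k) M PowerSeries.X))
    (hC : ∀ j, IsIntegral
      (IntermediateField.adjoin K (Set.range fun o : Option (Fin r) => o.elim t γ))
      (algebraMap (PowerSeries k) M (PowerSeries.C (c j)))) :
    AlgebraicIndependent K (fun o : Option (Fin r) => o.elim t γ) := by
  have hy := (algebraicIndependent_X_C hc).map' (f := IsScalarTower.toAlgHom K (PowerSeries k) M)
    (IsFractionRing.injective (PowerSeries k) M)
  refine hy.of_isAlgebraic_adjoin fun o => ?_
  cases o with
  | none => exact hX.isAlgebraic
  | some j => exact (hC j).isAlgebraic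

end Independence

/-! ### Local monodromy near degenerate polynomials -/

section Degenerate

variable {k : Type*} [Field k] [Algebra ℚ k] {r : ℕ}

/-- A critical point at 0 makes the origin a double zero of `critPoly a`, so each iteration sends `T
+ O(T²)` to `T + O(T²)`. This provides the simple root needed for Hensel's lemma. -/
theorem X_sq_dvd_critIter_sub_X {a : Fin r → k} {i : Fin r} (hi : a i = 0) (n : ℕ) :
    X ^ 2 ∣ critIter (C ∘ a) X n X - X := by
  induction n with
  | zero => simp
  | succ n ih =>
    rw [critIter_succ', eval_critPoly_C_comp, add_sub_cancel_right]
    obtain ⟨h, hh⟩ := X_sq_dvd_critPoly hi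
    rw [hh, mul_comp, pow_comp, X_comp]
    refine Dvd.dvd.mul_right (pow_dvd_pow_of_dvd ?_ 2) _
    have := (dvd_pow_self (X : k[X]) two_ne_zero).trans ih
    exact (dvd_sub_left dvd_rfl).1 this

/-- The vertex `t - X` is chosen because its fibre is given by `critPoly γ + X`, a polynomial with a
uniformiser as constant term. Modulo `X` the equation for `t` reads `T + T² q = 0`, with simple root
0. -/
theorem exists_param_of_degenerate (hr : 1 ≤ r) {γ : Fin r → PowerSeries k} {i : Fin r}
    (hi : PowerSeries.constantCoeff (γ i) = 0) (n : ℕ) :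
    ∃ t : PowerSeries k, critIter γ t n (t - PowerSeries.X) = γ i := by
  set Φ : (PowerSeries k)[X] := critIter (C ∘ γ) X n (X - C PowerSeries.X) - C (γ i) with hΦ
  have h := critIter_poly_monic hr γ (monic_X_sub_C (PowerSeries.X : PowerSeries k))
    (natDegree_X_sub_C _) n
  have hmonic : Φ.Monic := by
    refine h.1.sub_of_left (degree_lt_degree ?_)
    rw [natDegree_C, h.2]
    positivity
  obtain ⟨q, hq⟩ := X_sq_dvd_critIter_sub_X (a := PowerSeries.constantCoeff ∘ γ) hi n
  have hmap : Φ.map PowerSeries.constantCoeff = X + X ^ 2 * q := by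
    rw [hΦ, Polynomial.map_sub, map_critIter_poly, map_C, hi, Polynomial.map_sub, map_X, map_C,
      PowerSeries.constantCoeff_X, C_0, sub_zero, sub_zero, ← hq]
    ring
  obtain ⟨t, ht, -⟩ := exists_root_of_simple_root hmonic (a := 0) (by simp [hmap])
    (by simp [hmap])
  refine ⟨t, ?_⟩
  rw [hΦ, eval_sub, eval_critIter, eval_sub, eval_X, eval_C, eval_C, sub_eq_zero] at ht
  exact ht

variable {M L : Type*} [Field M] [Algebra (PowerSeries k) M] [IsFractionRing (PowerSeries k) M]
  [Field L] [Algebra ℚ L] [Algebra M L] [Algebra (PowerSeries k) L]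
  [IsScalarTower (PowerSeries k) M L]

theorem aeval_critPoly_add_C (γ : Fin r → PowerSeries k) (b : PowerSeries k) (u : L) :
    aeval u (critPoly γ + C b) =
      (critPoly (algebraMap (PowerSeries k) L ∘ γ)).eval u + algebraMap _ L b := by
  rw [aeval_def, eval₂_add, eval₂_C, ← eval_map, critPoly_map]

theorem critPoly_add_C_monic {R : Type*} [CommRing R] [Algebra ℚ R] [Nontrivial R]
    (γ : Fin r → R) (b : R) :
    (critPoly γ + C b).Monic ∧ (critPoly γ + C b).natDegree = r + 1 := by
  have h : (C b).natDegree < (critPoly γ).natDegree := by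
    rw [natDegree_C, natDegree_critPoly]
    omega
  exact ⟨(critPoly_monic γ).add_of_left (degree_lt_degree h), by
    rw [natDegree_add_eq_left_of_natDegree_lt h, natDegree_critPoly]⟩

theorem coeff_zero_critPoly_add_C {R : Type*} [CommRing R] [Algebra ℚ R]
    (γ : Fin r → R) (b : R) : (critPoly γ + C b).coeff 0 = b := by
  rw [coeff_zero_eq_eval_zero, eval_add, critPoly_eval_zero, eval_C, zero_add]

theorem exists_algEquiv_of_totally_degenerate [Normal M L] {γ : Fin r → PowerSeries k}
    (hγ : PowerSeries.constantCoeff ∘ γ = 0) {u v : L}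
    (hu : (critPoly (algebraMap (PowerSeries k) L ∘ γ)).eval u +
      algebraMap (PowerSeries k) L PowerSeries.X = 0)
    (hv : (critPoly (algebraMap (PowerSeries k) L ∘ γ)).eval v +
      algebraMap (PowerSeries k) L PowerSeries.X = 0) :
    ∃ σ : Gal(L/M), σ u = v := by
  rw [← aeval_critPoly_add_C] at hu hv
  have h := critPoly_add_C_monic γ (PowerSeries.X : PowerSeries k)
  refine exists_algEquiv_of_eisenstein h.1 (by omega) ?_ ?_ hu hv
  · rw [h.2, Polynomial.map_add, critPoly_map, hγ, critPoly_zero, map_C,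
      PowerSeries.constantCoeff_X, C_0, add_zero]
  · rw [coeff_zero_critPoly_add_C, PowerSeries.coeff_one_X]
    exact one_ne_zero

/-- The reduction is `(x - (r + 1)) x ^ r`. Hensel lifts the simple root to `ρ`, and the cofactor is
Eisenstein: its constant term divides `X` and vanishes modulo `X`, so it has order exactly one. -/
theorem exists_algEquiv_of_almost_degenerate [Normal M L] (hr : 1 ≤ r)
    {γ : Fin r → PowerSeries k} {j : Fin r}
    (hγ : PowerSeries.constantCoeff ∘ γ = Function.update (0 : Fin r → k) j r) :
    ∃ ρ : PowerSeries k, (critPoly (algebraMap (PowerSeries k) L ∘ γ)).eval (algebraMap _ L ρ) +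
        algebraMap (PowerSeries k) L PowerSeries.X = 0 ∧
      ∀ u v : L, (critPoly (algebraMap (PowerSeries k) L ∘ γ)).eval u +
        algebraMap (PowerSeries k) L PowerSeries.X = 0 →
      (critPoly (algebraMap (PowerSeries k) L ∘ γ)).eval v +
        algebraMap (PowerSeries k) L PowerSeries.X = 0 →
      u ≠ algebraMap _ L ρ → v ≠ algebraMap _ L ρ → ∃ σ : Gal(L/M), σ u = v := by
  have hk : CharZero k := algebraRat.charZero k
  set p : (PowerSeries k)[X] := critPoly γ + C PowerSeries.X with hp
  have h := critPoly_add_C_monic γ (PowerSeries.X : PowerSeries k)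
  have hred : p.map PowerSeries.constantCoeff = (X - C (r + 1 : k)) * X ^ r := by
    have := critPoly_update (R := k) hr j 1
    rw [mul_one] at this
    rw [hp, Polynomial.map_add, critPoly_map, hγ, this, map_C, PowerSeries.constantCoeff_X, C_0,
      add_zero, mul_one]
    ring
  have hr1 : (r + 1 : k) ≠ 0 := by exact_mod_cast r.succ_ne_zero
  obtain ⟨ρ, hρ, hρ'⟩ := exists_root_of_simple_root h.1 (a := (r + 1 : k))
    (by rw [← hp, hred]; simp) (by rw [← hp, hred]; simp [hr1])
  obtain ⟨Q, hQ⟩ := dvd_iff_isRoot.2 (show p.IsRoot ρ from hρ)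
  have hQm : Q.Monic := (monic_X_sub_C ρ).of_mul_monic_left (hQ ▸ h.1)
  have hQd : Q.natDegree = r := by
    have := congrArg natDegree hQ
    rw [(monic_X_sub_C ρ).natDegree_mul hQm, natDegree_X_sub_C, h.2] at this
    omega
  have hQred : Q.map PowerSeries.constantCoeff = X ^ r := by
    rw [hQ, Polynomial.map_mul, Polynomial.map_sub, map_X, map_C, hρ'] at hred
    exact mul_left_cancel₀ (X_sub_C_ne_zero _) hred
  have hQ0 : PowerSeries.coeff 1 (Q.coeff 0) ≠ 0 := by
    intro h1
    have h0 : PowerSeries.constantCoeff (Q.coeff 0) = 0 := by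
      rw [← coeff_map, hQred, coeff_X_pow, if_neg (by omega)]
    have hdvd : PowerSeries.X ^ 2 ∣ Q.coeff 0 := by
      rw [PowerSeries.X_pow_dvd_iff]
      intro m hm
      interval_cases m
      · rwa [PowerSeries.coeff_zero_eq_constantCoeff_apply]
      · exact h1
    have hX : (PowerSeries.X : PowerSeries k) = (X - C ρ).coeff 0 * Q.coeff 0 := by
      rw [← mul_coeff_zero, ← hQ, coeff_zero_critPoly_add_C]
    have hX2 : (PowerSeries.X : PowerSeries k) ^ 2 ∣ PowerSeries.X := by
      have := hdvd.mul_left ((X - C ρ).coeff 0)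
      rwa [← hX] at this
    have := PowerSeries.X_pow_dvd_iff.1 hX2 1 (by norm_num)
    rw [PowerSeries.coeff_one_X] at this
    exact one_ne_zero this
  refine ⟨ρ, ?_, fun u v hu hv huρ hvρ => ?_⟩
  · rw [← aeval_critPoly_add_C, aeval_def, eval₂_at_apply, hρ, map_zero]
  · have key : ∀ w : L, (critPoly (algebraMap (PowerSeries k) L ∘ γ)).eval w +
        algebraMap (PowerSeries k) L PowerSeries.X = 0 → w ≠ algebraMap _ L ρ → aeval w Q = 0 := by
      intro w hw hwρ
      rw [← aeval_critPoly_add_C, ← hp, hQ, map_mul, map_sub, aeval_X, aeval_C] at hw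
      exact (mul_eq_zero.1 hw).resolve_left (sub_ne_zero.2 hwρ)
    exact exists_algEquiv_of_eisenstein hQm (by omega) (by rw [hQd, hQred]) hQ0
      (key u hu huρ) (key v hv hvρ)

end Degenerate

/-! ### Monodromy near a parameter with a single critical relation -/

section FieldProperties

variable (B : Type*) {L : Type*} [Field B] [Field L] [Algebra ℚ L] [Algebra B L] {r : ℕ}
  (γ : Fin r → L) (t : L) (n : ℕ) (i : Fin r)

/-- Some automorphism transposes two siblings in the `(n + 1)`-st preimage of `γ i` and fixes
all other `(n + 1)`-st preimages of critical points. -/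
def GaloisSwap : Prop :=
  ∃ u v : L, u ≠ v ∧ (critPoly γ).eval u = (critPoly γ).eval v ∧ critIter γ t (n + 1) u = γ i ∧
    ∃ σ : Gal(L/B), σ u = v ∧ σ v = u ∧
      ∀ l z, critIter γ t (n + 1) z = γ l → z ≠ u → z ≠ v → σ z = z

/-- The Galois group is transitive on the fibre over some `n`-th preimage of `γ i`. -/
def GaloisTransitive : Prop :=
  ∃ x : L, critIter γ t n x = γ i ∧ ∀ u v, (critPoly γ).eval u + t = x →
    (critPoly γ).eval v + t = x → ∃ σ : Gal(L/B), σ u = v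

/-- The stabiliser of some `w` in the fibre over some `n`-th preimage of `γ i` is transitive on
the rest of that fibre. -/
def GaloisSiblings : Prop :=
  ∃ x : L, critIter γ t n x = γ i ∧ ∃ w, (critPoly γ).eval w + t = x ∧
    ∀ u v, (critPoly γ).eval u + t = x → (critPoly γ).eval v + t = x → u ≠ w → v ≠ w →
      ∃ σ : Gal(L/B), σ w = w ∧ σ u = v

end FieldProperties

section

variable {R : Type*} [CommRing R] [Algebra ℚ R] {r : ℕ}

theorem dvd_critIter_sub_critIter (γ : Fin r → R) (t : R) (n : ℕ) {b x y : R} (h : b ∣ x - y) :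
    b ∣ critIter γ t n x - critIter γ t n y := by
  induction n with
  | zero => exact h
  | succ n ih =>
    rw [critIter_succ', critIter_succ', add_sub_add_right_eq_sub]
    exact ih.trans (sub_dvd_eval_sub _ _ _)

theorem eval_derivative_critPoly_self (γ : Fin r → R) (i : Fin r) :
    (derivative (critPoly γ)).eval (γ i) = 0 := by
  rw [derivative_critPoly, eval_mul, eval_prod,
    Finset.prod_eq_zero (Finset.mem_univ i) (by simp), mul_zero]

theorem eq_of_eval_derivative_critPoly {F : Type*} [Field F] [Algebra ℚ F] {γ : Fin r → F} {a : F}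
    (h : (derivative (critPoly γ)).eval a = 0) : ∃ i, a = γ i := by
  have : CharZero F := algebraRat.charZero F
  rw [derivative_critPoly, eval_mul, eval_C, eval_prod, mul_eq_zero, Finset.prod_eq_zero_iff] at h
  rcases h with h | ⟨i, -, h⟩
  · exact absurd h (by exact_mod_cast r.succ_ne_zero)
  · exact ⟨i, by simpa [sub_eq_zero] using h⟩

end

section LocalSwap

variable {k : Type*} [Field k] [Algebra ℚ k] {r : ℕ} {c : Fin r → k} {τ : k}

/-- Reduction of a fibre polynomial over the power series ring. -/
theorem map_critPoly_add_C (x : PowerSeries k) :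
    (critPoly (PowerSeries.C ∘ c) + C (PowerSeries.C τ + PowerSeries.X - x)).map
      PowerSeries.constantCoeff = critPoly c + C (τ - PowerSeries.constantCoeff x) := by
  rw [Polynomial.map_add, critPoly_map, map_C]
  congr 2
  simp

theorem constantCoeff_critIter (m : ℕ) (x : PowerSeries k) :
    PowerSeries.constantCoeff
      (critIter (PowerSeries.C ∘ c) (PowerSeries.C τ + PowerSeries.X) m x) =
      critIter c τ m (PowerSeries.constantCoeff x) := by
  rw [map_critIter]
  congr 1
  simp

theorem eval_derivative_fibre_ne_zero {a b : k}
    (ha : ∀ i, a ≠ c i) : (derivative (critPoly c + C b)).eval a ≠ 0 := by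
  intro h
  rw [derivative_add, derivative_C, add_zero] at h
  obtain ⟨i, hi⟩ := eq_of_eval_derivative_critPoly h
  exact ha i hi

/-- A critical point in the reduced tree at a positive level up to `n` would be a critical relation
excluded by `h3`, so every step up the tree is a Hensel lift of a simple root. -/
theorem exists_lift_of_critIter_eq {n : ℕ}
    (h3 : ∀ m < n, ∀ i l, critIter c τ (m + 1) (c i) ≠ c l) {m : ℕ} (hm : m ≤ n) {b : k}
    {l : Fin r} (hb : critIter c τ m b = c l) :
    ∃ x : PowerSeries k, PowerSeries.constantCoeff x = b ∧
      critIter (PowerSeries.C ∘ c) (PowerSeries.C τ + PowerSeries.X) m x = PowerSeries.C (c l) := by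
  induction m generalizing b with
  | zero =>
    obtain rfl : b = c l := hb
    exact ⟨PowerSeries.C (c l), by simp, rfl⟩
  | succ m ih =>
    obtain ⟨x₁, hx₁, hx₁'⟩ := ih (by omega) (b := (critPoly c).eval b + τ) hb
    obtain ⟨x, hx, hxb⟩ := exists_root_of_simple_root (critPoly_add_C_monic (PowerSeries.C ∘ c)
        (PowerSeries.C τ + PowerSeries.X - x₁)).1 (a := b)
      (by rw [map_critPoly_add_C, hx₁]; simp) (by
        rw [map_critPoly_add_C]
        refine eval_derivative_fibre_ne_zero fun i hi => h3 m (by omega) i l ?_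
        rw [← hi, hb])
    refine ⟨x, hxb, ?_⟩
    rw [eval_add, eval_C, ← add_sub_assoc, sub_eq_zero] at hx
    rw [critIter_succ, hx, hx₁']

theorem eq_of_fibre_eq {x x' : PowerSeries k}
    (h : (critPoly (PowerSeries.C ∘ c)).eval x = (critPoly (PowerSeries.C ∘ c)).eval x')
    (hx : PowerSeries.constantCoeff x = PowerSeries.constantCoeff x')
    (hc : ∀ i, PowerSeries.constantCoeff x ≠ c i) : x = x' := by
  let y := (critPoly (PowerSeries.C ∘ c)).eval x + (PowerSeries.C 0 + PowerSeries.X)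
  refine root_unique_of_simple_root (p := critPoly (PowerSeries.C ∘ c) +
    C (PowerSeries.C 0 + PowerSeries.X - y)) ?_ ?_ hx ?_
  · simp [y]
  · simp [y, h]
  · rw [map_critPoly_add_C]
    exact eval_derivative_fibre_ne_zero hc

theorem eq_of_critIter_eq {n : ℕ} (h3 : ∀ m < n, ∀ i l, critIter c τ (m + 1) (c i) ≠ c l) {m : ℕ}
    (hm : m ≤ n) {x x' : PowerSeries k} {l : Fin r}
    (hx : critIter (PowerSeries.C ∘ c) (PowerSeries.C τ + PowerSeries.X) m x = PowerSeries.C (c l))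
    (hx' : critIter (PowerSeries.C ∘ c) (PowerSeries.C τ + PowerSeries.X) m x' =
      PowerSeries.C (c l))
    (h : PowerSeries.constantCoeff x = PowerSeries.constantCoeff x') : x = x' := by
  induction m generalizing x x' with
  | zero => exact hx.trans hx'.symm
  | succ m ih =>
    have h1 := ih (by omega) hx hx' (by
      have e := constantCoeff_critIter (c := c) (τ := τ) 1
      exact (e x).trans (by rw [h]; exact (e x').symm))
    refine eq_of_fibre_eq (add_right_cancel h1) h fun i hi => h3 m (by omega) i l ?_
    rw [← hi, ← constantCoeff_critIter, hx, PowerSeries.constantCoeff_C]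

/-- At a simple solution of the critical relation, no power series solves the next fibre equation
near the critical point. -/
theorem constantCoeff_ne_of_fibre_eq {n : ℕ} {j : Fin r}
    (h1 : critIter c τ (n + 1) (c j) = c j)
    (h2 : (derivative (relPoly c n (c j) (c j))).eval τ ≠ 0) {y x : PowerSeries k}
    (hy : critIter (PowerSeries.C ∘ c) (PowerSeries.C τ + PowerSeries.X) n y = PowerSeries.C (c j))
    (hx : (critPoly (PowerSeries.C ∘ c)).eval x + (PowerSeries.C τ + PowerSeries.X) = y) :
    PowerSeries.constantCoeff x ≠ c j := by
  intro hxj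
  set t : PowerSeries k := PowerSeries.C τ + PowerSeries.X with ht
  set γ : Fin r → PowerSeries k := PowerSeries.C ∘ c with hγ
  have hX : PowerSeries.X ∣ x - γ j := by
    rw [PowerSeries.X_dvd_iff, map_sub, hxj]
    simp [hγ]
  have hX2 : PowerSeries.X ^ 2 ∣ y - ((critPoly γ).eval (γ j) + t) := by
    obtain ⟨q, hq⟩ := binomExpansion (critPoly γ) (γ j) (x - γ j)
    rw [add_sub_cancel, eval_derivative_critPoly_self, zero_mul, add_zero] at hq
    rw [← hx, hq, add_sub_add_right_eq_sub, add_sub_cancel_left]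
    exact (pow_dvd_pow_of_dvd hX 2).mul_left _
  have hrel := dvd_critIter_sub_critIter γ t n hX2
  rw [hy, ← critIter_succ, dvd_sub_comm] at hrel
  have he : critIter γ t (n + 1) (γ j) - PowerSeries.C (c j) =
      ((relPoly c n (c j) (c j)).map PowerSeries.C).eval t := by
    rw [map_relPoly, eval_relPoly]
    rfl
  rw [he, ht] at hrel
  obtain ⟨q, hq⟩ := binomExpansion ((relPoly c n (c j) (c j)).map PowerSeries.C) (PowerSeries.C τ)
    PowerSeries.X
  rw [hq, eval_map, eval₂_at_apply, eval_relPoly, h1, sub_self, map_zero, zero_add, derivative_map,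
    eval_map, eval₂_at_apply, dvd_add_left (dvd_mul_left _ _), PowerSeries.X_pow_dvd_iff] at hrel
  have := hrel 1 (by norm_num)
  rw [PowerSeries.coeff_C_mul, PowerSeries.coeff_one_X, mul_one] at this
  exact h2 this

/-- The derivative has only simple roots, so `c j` is exactly a double root; no other critical point
lies in its fibre, so the remaining `r - 1` roots are simple. -/
theorem card_simple_roots_fibre [IsAlgClosed k] [DecidableEq k] (hc : Function.Injective c)
    {j : Fin r} (h : ∀ i, (critPoly c).eval (c i) = (critPoly c).eval (c j) → i = j) :
    ((critPoly c + C (-(critPoly c).eval (c j))).roots.toFinset.erase (c j)).card + 2 = r + 1 := by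
  have hk : CharZero k := algebraRat.charZero k
  set p := critPoly c + C (-(critPoly c).eval (c j)) with hp
  have hm := critPoly_add_C_monic c (-(critPoly c).eval (c j))
  have hder : derivative p = derivative (critPoly c) := by simp [hp]
  have hroot : ∀ a, p.IsRoot a → a ≠ c j → (derivative p).eval a ≠ 0 := by
    intro a ha haj h0
    rw [hder] at h0
    obtain ⟨i, rfl⟩ := eq_of_eval_derivative_critPoly h0
    refine haj (congrArg c (h i ?_))
    rw [IsRoot, hp, eval_add, eval_C, ← sub_eq_add_neg, sub_eq_zero] at ha
    exact ha
  have hj : p.IsRoot (c j) := by simp [hp, IsRoot]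
  have hcount : p.roots.count (c j) = 2 := by
    have h1 := derivative_rootMultiplicity_of_root hj
    have h2 : (derivative p).rootMultiplicity (c j) = 1 := by
      rw [hder, derivative_critPoly, ← count_roots, roots_C_mul _ (by exact_mod_cast r.succ_ne_zero),
        show ∏ i, (X - C (c i)) = ((Finset.univ.val.map c).map fun a => X - C a).prod by
          rw [Multiset.map_map]; rfl,
        roots_multiset_prod_X_sub_C, Multiset.count_map_eq_count' _ _ hc,
        Multiset.count_eq_one_of_mem Finset.univ.nodup (Finset.mem_univ j)]
    rw [count_roots]
    omega
  have hsum := Multiset.toFinset_sum_count_eq p.roots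
  have hmem : c j ∈ p.roots.toFinset := by
    rw [Multiset.mem_toFinset, mem_roots hm.1.ne_zero]
    exact hj
  rw [← Finset.sum_erase_add _ _ hmem, hcount, Finset.sum_congr rfl (g := fun _ => 1),
    Finset.sum_const, smul_eq_mul, mul_one, splits_iff_card_roots.1 (IsAlgClosed.splits p),
    hm.2] at hsum
  · exact hsum
  · intro a ha
    rw [Finset.mem_erase, Multiset.mem_toFinset, mem_roots hm.1.ne_zero] at ha
    rw [count_roots]
    refine le_antisymm ?_ ?_
    · by_contra! hlt
      exact hroot a ha.2 ha.1 ((one_lt_rootMultiplicity_iff_isRoot hm.1.ne_zero).1 hlt).2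
    · exact (rootMultiplicity_pos hm.1.ne_zero).2 ha.2

variable {M L : Type*} [Field M] [Algebra (PowerSeries k) M] [IsFractionRing (PowerSeries k) M]
  [Field L] [Algebra ℚ L] [Algebra M L] [Algebra (PowerSeries k) L]
  [IsScalarTower (PowerSeries k) M L]

/-- Away from the critical values the reduced fibre is separable, so the whole fibre is unramified
and rational over the power series. -/
theorem exists_lift_of_fibre [IsAlgClosed k] {y : PowerSeries k}
    (hy : ∀ i, (critPoly c).eval (c i) + τ ≠ PowerSeries.constantCoeff y) {z : L}
    (hz : (critPoly (algebraMap (PowerSeries k) L ∘ PowerSeries.C ∘ c)).eval z +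
      algebraMap (PowerSeries k) L (PowerSeries.C τ + PowerSeries.X) = algebraMap _ L y) :
    ∃ x : PowerSeries k, algebraMap _ L x = z ∧
      (critPoly (PowerSeries.C ∘ c)).eval x + (PowerSeries.C τ + PowerSeries.X) = y := by
  obtain ⟨x, hx, hxz⟩ := exists_algebraMap_eq_of_separable (L := L) (y := z)
    (critPoly_add_C_monic (PowerSeries.C ∘ c) (PowerSeries.C τ + PowerSeries.X - y)).1
    (fun a ha => by
      rw [map_critPoly_add_C] at ha ⊢
      refine eval_derivative_fibre_ne_zero fun i hi => hy i ?_
      rw [eval_add, eval_C, ← add_sub_assoc, sub_eq_zero] at ha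
      rw [← hi, ha])
    (by rw [aeval_critPoly_add_C, map_sub, ← add_sub_assoc, hz, sub_self])
  refine ⟨x, hxz, ?_⟩
  rwa [eval_add, eval_C, ← add_sub_assoc, sub_eq_zero] at hx

theorem exists_lift_of_level [IsAlgClosed k] {n : ℕ}
    (h3 : ∀ m < n, ∀ i l, critIter c τ (m + 1) (c i) ≠ c l) {m : ℕ} (hm : m ≤ n) {z : L} {l : Fin r}
    (hz : critIter (algebraMap (PowerSeries k) L ∘ PowerSeries.C ∘ c)
      (algebraMap (PowerSeries k) L (PowerSeries.C τ + PowerSeries.X)) m z =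
      algebraMap (PowerSeries k) L (PowerSeries.C (c l))) :
    ∃ x : PowerSeries k, algebraMap _ L x = z ∧
      critIter (PowerSeries.C ∘ c) (PowerSeries.C τ + PowerSeries.X) m x = PowerSeries.C (c l) := by
  induction m generalizing z with
  | zero => exact ⟨PowerSeries.C (c l), hz.symm, rfl⟩
  | succ m ih =>
    obtain ⟨y, hy, hy'⟩ := ih (by omega) hz
    obtain ⟨x, hx, hx'⟩ := exists_lift_of_fibre (fun i hi => h3 m (by omega) i l (by
      rw [critIter_succ, hi, ← constantCoeff_critIter, hy', PowerSeries.constantCoeff_C])) hy.symm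
    exact ⟨x, hx, by rw [critIter_succ, hx', hy']⟩

/-- Up to level `n` all trees consist of power series, and just one fibre above, that of `y`, fails
to be unramified. Of its `r + 1` points exactly `r - 1` are power series; the other two form a
Galois-stable pair outside `M`, hence are swapped. -/
theorem galoisSwap_of_unique_critical_relation [IsAlgClosed k] [IsAlgClosed L] [IsGalois M L]
    (hc : Function.Injective c) {n : ℕ} {j : Fin r}
    (h1 : critIter c τ (n + 1) (c j) = c j)
    (h2 : (derivative (relPoly c n (c j) (c j))).eval τ ≠ 0)
    (h3 : ∀ m ≤ n, ∀ i l, critIter c τ (m + 1) (c i) = c l → m = n ∧ i = j ∧ l = j)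
    (h4 : ∀ i, critIter (algebraMap (PowerSeries k) L ∘ PowerSeries.C ∘ c)
      (algebraMap (PowerSeries k) L (PowerSeries.C τ + PowerSeries.X)) (n + 1)
      (algebraMap (PowerSeries k) L (PowerSeries.C (c i))) ≠
        algebraMap (PowerSeries k) L (PowerSeries.C (c j))) :
    GaloisSwap M (algebraMap (PowerSeries k) L ∘ PowerSeries.C ∘ c)
      (algebraMap (PowerSeries k) L (PowerSeries.C τ + PowerSeries.X)) n j := by
  classical
  set ι := algebraMap (PowerSeries k) L with hι
  have hιinj : Function.Injective ι := by
    rw [hι, IsScalarTower.algebraMap_eq (PowerSeries k) M L]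
    exact (algebraMap M L).injective.comp (IsFractionRing.injective _ _)
  set t : PowerSeries k := PowerSeries.C τ + PowerSeries.X with ht
  set γ : Fin r → PowerSeries k := PowerSeries.C ∘ c with hγ
  have h3' : ∀ m < n, ∀ i l, critIter c τ (m + 1) (c i) ≠ c l := fun m hm i l h =>
    hm.ne (h3 m hm.le i l h).1
  have hfix : ∀ (σ : Gal(L/M)) x, σ (ι x) = ι x := fun σ x => by
    rw [hι, IsScalarTower.algebraMap_apply (PowerSeries k) M L, AlgEquiv.commutes]
  -- the vertex whose fibre degenerates
  obtain ⟨y, hyev, hy⟩ := exists_lift_of_critIter_eq h3' le_rfl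
    (b := (critPoly c).eval (c j) + τ) (l := j) h1
  have hother : ∀ (l : Fin r) (y' : PowerSeries k), critIter γ t n y' = PowerSeries.C (c l) →
      y' ≠ y → ∀ i, (critPoly c).eval (c i) + τ ≠ PowerSeries.constantCoeff y' := by
    intro l y' hy' hne i hi
    obtain ⟨-, rfl, rfl⟩ := h3 n le_rfl i l (by
      rw [critIter_succ, hi, ← constantCoeff_critIter, hy', PowerSeries.constantCoeff_C])
    exact hne (eq_of_critIter_eq h3' le_rfl hy' hy (by rw [hyev, hi]))
  -- the fibre over `y`
  set p : (PowerSeries k)[X] := critPoly γ + C (t - y) with hp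
  have hpm := critPoly_add_C_monic γ (t - y)
  have hproot : ∀ x, x ∈ p.roots.toFinset ↔ (critPoly γ).eval x + t = y := by
    intro x
    rw [Multiset.mem_toFinset, mem_roots hpm.1.ne_zero, IsRoot, eval_add, eval_C,
      ← add_sub_assoc, sub_eq_zero]
  set P : L[X] := p.map ι with hP
  have hPm : P.Monic := hpm.1.map _
  have hProot : ∀ z, z ∈ P.roots.toFinset ↔ (critPoly (ι ∘ γ)).eval z + ι t = ι y := by
    intro z
    rw [Multiset.mem_toFinset, mem_roots hPm.ne_zero, IsRoot, hP, eval_map, ← aeval_def, hp,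
      aeval_critPoly_add_C, map_sub, ← add_sub_assoc, sub_eq_zero]
  have hyL : critIter (ι ∘ γ) (ι t) n (ι y) = ι (PowerSeries.C (c j)) := by
    rw [← map_critIter, hy]
  -- A multiple root over `L` would be a critical point and give a relation excluded by `h4`.
  have hPcard : P.roots.toFinset.card = r + 1 := by
    rw [Multiset.toFinset_card_of_nodup, splits_iff_card_roots.1 (IsAlgClosed.splits P),
      hpm.1.natDegree_map, hpm.2]
    rw [Multiset.nodup_iff_count_le_one]
    intro z
    rw [count_roots]
    by_contra! h
    obtain ⟨hz, hz'⟩ := (one_lt_rootMultiplicity_iff_isRoot hPm.ne_zero).1 h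
    rw [hP, hp, Polynomial.map_add, map_C, derivative_add, derivative_C, add_zero, critPoly_map,
      IsRoot] at hz'
    obtain ⟨i, rfl⟩ := eq_of_eval_derivative_critPoly hz'
    refine h4 i ?_
    rw [critIter_succ, ← hyL]
    congr 1
    exact (hProot _).1 (by rw [Multiset.mem_toFinset, mem_roots hPm.ne_zero]; exact hz)
  -- Reduction matches the power series roots with the simple roots of the reduced fibre: simple
  -- roots lift uniquely, and nothing lifts the double root by `constantCoeff_ne_of_fibre_eq`.
  have hpcard : p.roots.toFinset.card + 2 = r + 1 := by
    have hcrit : ∀ i, (critPoly c).eval (c i) = (critPoly c).eval (c j) → i = j := fun i hi =>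
      (h3 n le_rfl i j (by rw [critIter_succ, hi, ← critIter_succ, h1])).2.1
    rw [← card_simple_roots_fibre hc hcrit]
    congr 1
    set q := critPoly c + C (-(critPoly c).eval (c j)) with hq
    have hqm := critPoly_add_C_monic c (-(critPoly c).eval (c j))
    have hqp : p.map PowerSeries.constantCoeff = q := by
      rw [hp, hγ, ht, map_critPoly_add_C, hyev, hq]
      congr 2
      ring
    have hqroot : ∀ a, a ∈ q.roots.toFinset.erase (c j) ↔
        a ≠ c j ∧ (critPoly c).eval a = (critPoly c).eval (c j) := by
      intro a
      rw [Finset.mem_erase, Multiset.mem_toFinset, mem_roots hqm.1.ne_zero, IsRoot, eval_add,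
        eval_C, ← sub_eq_add_neg, sub_eq_zero]
    have hnc : ∀ a ∈ q.roots.toFinset.erase (c j), ∀ i, a ≠ c i := by
      rintro _ ha i rfl
      rw [hqroot] at ha
      exact ha.1 (congrArg c (hcrit i ha.2))
    have hmaps : ∀ x ∈ p.roots.toFinset,
        PowerSeries.constantCoeff x ∈ q.roots.toFinset.erase (c j) := by
      intro x hx
      rw [hproot] at hx
      rw [hqroot]
      refine ⟨constantCoeff_ne_of_fibre_eq h1 h2 hy hx, ?_⟩
      have := constantCoeff_critIter (c := c) (τ := τ) 1 x
      rw [critIter_succ', critIter_zero, ← hγ, ← ht, hx, hyev] at this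
      exact (add_right_cancel this).symm
    refine Finset.card_nbij PowerSeries.constantCoeff hmaps ?_ ?_
    · intro x hx x' hx' h
      have e1 := (hproot x).1 hx
      have e2 := (hproot x').1 hx'
      exact eq_of_fibre_eq (add_right_cancel (e1.trans e2.symm)) h (hnc _ (hmaps x hx))
    · intro a ha
      have ha' := (hqroot a).1 ha
      obtain ⟨x, hx, hxa⟩ := exists_root_of_simple_root hpm.1 (a := a)
        (by rw [← hp, hqp, hq, eval_add, eval_C, ha'.2, add_neg_cancel])
        (by rw [← hp, hqp]; exact eval_derivative_fibre_ne_zero (hnc a ha))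
      refine ⟨x, ?_, hxa⟩
      rw [Finset.mem_coe, Multiset.mem_toFinset, mem_roots hpm.1.ne_zero]
      exact hx
  have hsub : p.roots.toFinset.image ι ⊆ P.roots.toFinset := by
    intro z hz
    obtain ⟨x, hx, rfl⟩ := Finset.mem_image.1 hz
    rw [hProot, ← (hproot x).1 hx, map_add ι _ t, ← critPoly_map, eval_map, eval₂_at_apply]
  obtain ⟨u, v, huv, huv'⟩ : ∃ u v, u ≠ v ∧
      P.roots.toFinset \ p.roots.toFinset.image ι = {u, v} := by
    rw [← Finset.card_eq_two, Finset.card_sdiff_of_subset hsub,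
      Finset.card_image_of_injective _ hιinj, hPcard]
    omega
  have hmem : ∀ z, (z = u ∨ z = v) ↔
      (critPoly (ι ∘ γ)).eval z + ι t = ι y ∧ z ∉ Set.range ι := by
    intro z
    have hz : (z = u ∨ z = v) ↔ z ∈ ({u, v} : Finset L) := by simp
    rw [hz, ← huv', Finset.mem_sdiff, hProot]
    refine and_congr_right fun hz => not_congr ?_
    rw [Finset.mem_image]
    constructor
    · rintro ⟨x, -, rfl⟩
      exact ⟨x, rfl⟩
    · rintro ⟨x, rfl⟩
      refine ⟨x, (hproot x).2 (hιinj ?_), rfl⟩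
      rwa [map_add, ← eval₂_at_apply, ← eval_map, critPoly_map]
  have hu := (hmem u).1 (Or.inl rfl)
  have hv := (hmem v).1 (Or.inr rfl)
  have hσ : ∀ σ : Gal(L/M), ∀ z, (z = u ∨ z = v) → (σ z = u ∨ σ z = v) := by
    intro σ z hz
    rw [hmem] at hz ⊢
    constructor
    · have := congrArg σ hz.1
      rw [hfix, map_add, hfix] at this
      rw [← this]
      congr 1
      have e := Polynomial.eval₂_at_apply (p := critPoly (ι ∘ γ)) (σ : L →+* L) z
      rw [← eval_map, critPoly_map] at e
      rwa [show (σ : L →+* L) ∘ ι ∘ γ = ι ∘ γ from funext fun i => hfix σ _] at e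
    · rintro ⟨x, hx⟩
      refine hz.2 ⟨x, σ.injective ?_⟩
      rw [hfix, hx]
  -- A point fixed by all automorphisms lies in `M`; being integral over the integrally closed ring
  -- of power series, it would itself be a power series.
  obtain ⟨σ, hσu⟩ : ∃ σ : Gal(L/M), σ u ≠ u := by
    by_contra! hall
    obtain ⟨w, hw⟩ := (InfiniteGalois.mem_range_algebraMap_iff_fixed u).2 hall
    have hint : IsIntegral (PowerSeries k) w := by
      refine ⟨p, hpm.1, (algebraMap M L).injective ?_⟩
      rw [map_zero, hom_eval₂, ← IsScalarTower.algebraMap_eq, hw, ← eval_map]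
      have := (hProot u).2 hu.1
      rw [Multiset.mem_toFinset, mem_roots hPm.ne_zero] at this
      exact this
    obtain ⟨x, rfl⟩ := IsIntegrallyClosed.isIntegral_iff.1 hint
    exact hu.2 ⟨x, by rw [← hw, hι, ← IsScalarTower.algebraMap_apply]⟩
  have hσu' : σ u = v := (hσ σ u (Or.inl rfl)).resolve_left hσu
  have hσv : σ v = u := (hσ σ v (Or.inr rfl)).resolve_right fun h =>
    huv (σ.injective (hσu'.trans h.symm))
  refine ⟨u, v, huv, add_right_cancel (hu.1.trans hv.1.symm), ?_, σ, hσu', hσv, ?_⟩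
  · rw [critIter_succ, hu.1]
    exact hyL
  · intro l z hz hzu hzv
    rw [critIter_succ] at hz
    obtain ⟨y', hy', hy''⟩ := exists_lift_of_level (L := L) h3' le_rfl hz
    by_cases hyy : y' = y
    · by_contra hne
      have : z ∉ Set.range ι := by
        rintro ⟨x, rfl⟩
        exact hne (hfix σ x)
      exact ((hmem z).2 ⟨by rw [← hy', hyy], this⟩).elim hzu hzv
    · obtain ⟨x, hx, -⟩ := exists_lift_of_fibre (hother l y' hy'' hyy) hy'.symm
      rw [← hx, ← hι, hfix]

end LocalSwap

/-! ### Transfer from power series fields to the generic polynomial -/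

universe u

section Generic

variable {K : Type*} [Field K] [CharZero K] {r : ℕ}

/-- The generic polynomial has no critical relations. -/
theorem critIter_ne_of_algebraicIndependent {L : Type*} [Field L] [Algebra ℚ L] [Algebra K L]
    (hr : 1 ≤ r) {γ : Fin r → L} {t : L}
    (h : AlgebraicIndependent K (fun o : Option (Fin r) => o.elim t γ)) (m : ℕ) (i l : Fin r) :
    critIter γ t (m + 1) (γ i) ≠ γ l := by
  intro he
  have ht := (AlgebraicIndependent.option_iff.1 h).2
  let γ₀ : Fin r → Algebra.adjoin K (Set.range γ) := fun j =>
    ⟨γ j, Algebra.subset_adjoin ⟨j, rfl⟩⟩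
  refine (relPoly_monic hr γ₀ m (γ₀ i) (γ₀ l)).1.ne_zero (transcendental_iff.1 ht _ ?_)
  rw [aeval_def, ← eval_map, map_relPoly, eval_relPoly, sub_eq_zero]
  exact he

theorem exists_isAlgClosed_algebraicIndependent (K : Type u) [Field K] (r : ℕ) :
    ∃ (k : Type u) (_ : Field k) (_ : Algebra K k) (_ : IsAlgClosed k) (c : Fin r → k),
      AlgebraicIndependent K c := by
  refine ⟨AlgebraicClosure (FractionRing (MvPolynomial (Fin r) K)), inferInstance, inferInstance,
    inferInstance, fun j => algebraMap (MvPolynomial (Fin r) K) _ (MvPolynomial.X j), ?_⟩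
  exact (MvPolynomial.algebraicIndependent_X (Fin r) K).map'
    (f := IsScalarTower.toAlgHom K (MvPolynomial (Fin r) K)
      (AlgebraicClosure (FractionRing (MvPolynomial (Fin r) K))))
    ((algebraMap (FractionRing (MvPolynomial (Fin r) K)) _).injective.comp
      (IsFractionRing.injective (MvPolynomial (Fin r) K) _))

end Generic

section Transfer

variable {K : Type*} [Field K] {r : ℕ}
  {B A M L : Type*} [Field B] [Field A] [Field M] [Field L] [Algebra B A] [Algebra M L]

/-- Extend the embedding of `B` in `M` to the algebraic closures. Since `A` is normal over `B`, its
image in `L` is stable under automorphisms over `M`, which therefore restrict. -/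
theorem exists_ringHom_of_algebraicIndependent [Algebra K B] [Algebra K M]
    [Algebra.IsAlgebraic B A] [IsAlgClosed A] [IsAlgClosed L] {γ : Fin r → B} {t : B}
    (h : AlgebraicIndependent K (fun o : Option (Fin r) => o.elim t γ))
    (hgen : IntermediateField.adjoin K (Set.range fun o : Option (Fin r) => o.elim t γ) = ⊤)
    {γ' : Fin r → M} {t' : M}
    (h' : AlgebraicIndependent K (fun o : Option (Fin r) => o.elim t' γ')) :
    ∃ ψ : A →+* L, ψ ∘ algebraMap B A ∘ γ = algebraMap M L ∘ γ' ∧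
      ψ (algebraMap B A t) = algebraMap M L t' ∧
      ∀ σ' : Gal(L/M), ∃ σ : Gal(A/B), ∀ x, ψ (σ x) = σ' (ψ x) := by
  obtain ⟨ψ₀, hψ₀⟩ := h.exists_algHom hgen h'
  let _ : Algebra B L := ((algebraMap M L).comp ψ₀.toRingHom).toAlgebra
  let ψ : A →ₐ[B] L := IsAlgClosed.lift
  have hψ : ∀ b, ψ (algebraMap B A b) = algebraMap M L (ψ₀ b) := ψ.commutes
  let _ : Algebra A L := ψ.toRingHom.toAlgebra
  have _ : IsScalarTower B A L := IsScalarTower.of_algebraMap_eq fun b => (ψ.commutes b).symm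
  have _ : IsAlgClosure B A := ⟨inferInstance, inferInstance⟩
  have _ : Normal B A := IsAlgClosure.normal B A
  refine ⟨ψ.toRingHom, funext fun j => ?_, ?_, fun σ' => ?_⟩
  · exact (hψ _).trans (congrArg _ (hψ₀ (some j)))
  · exact (hψ _).trans (congrArg _ (hψ₀ none))
  · let σ'' : Gal(L/B) := AlgEquiv.ofRingEquiv (f := σ'.toRingEquiv) fun b => σ'.commutes (ψ₀ b)
    exact ⟨σ''.restrictNormal A, fun x => σ''.restrictNormal_commutes A x⟩

variable [Algebra ℚ A] [Algebra ℚ L]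

theorem exists_preimage_of_eval_critPoly [IsAlgClosed A] (ψ : A →+* L) {γ : Fin r → A} {x : A}
    {y : L} (h : (critPoly (ψ ∘ γ)).eval y = ψ x) :
    ∃ x', ψ x' = y ∧ (critPoly γ).eval x' = x := by
  have hm := critPoly_add_C_monic γ (-x)
  have hs := IsAlgClosed.splits (critPoly γ + C (-x))
  have hprod := prod_multiset_X_sub_C_of_monic_of_roots_card_eq hm.1 (splits_iff_card_roots.1 hs)
  have hy : (critPoly γ + C (-x)).eval₂ ψ y = 0 := by
    rw [eval₂_add, eval₂_C, ← eval_map, critPoly_map, h, map_neg, add_neg_cancel]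
  rw [← hprod, ← coe_eval₂RingHom, map_multiset_prod, Multiset.map_map, Multiset.prod_eq_zero_iff,
    Multiset.mem_map] at hy
  obtain ⟨x', hx', hy⟩ := hy
  refine ⟨x', ?_, ?_⟩
  · simp only [Function.comp_apply, coe_eval₂RingHom, eval₂_sub, eval₂_X, eval₂_C,
      sub_eq_zero] at hy
    exact hy.symm
  · rw [mem_roots hm.1.ne_zero, IsRoot, eval_add, eval_C, ← sub_eq_add_neg, sub_eq_zero] at hx'
    exact hx'

theorem exists_preimage_of_critIter [IsAlgClosed A] (ψ : A →+* L) {γ : Fin r → A} {t x : A}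
    {n : ℕ} {y : L} (h : critIter (ψ ∘ γ) (ψ t) n y = ψ x) :
    ∃ x', ψ x' = y ∧ critIter γ t n x' = x := by
  induction n generalizing y with
  | zero => exact ⟨x, h.symm, rfl⟩
  | succ n ih =>
    obtain ⟨z, hz, hzx⟩ := ih h
    obtain ⟨x', hx', hx''⟩ := exists_preimage_of_eval_critPoly ψ (γ := γ) (x := z - t) (y := y)
      (by rw [map_sub, hz, add_sub_cancel_right])
    exact ⟨x', hx', by rw [critIter_succ, hx'', sub_add_cancel, hzx]⟩

theorem map_eval_critPoly (ψ : A →+* L) (γ : Fin r → A) (x : A) :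
    ψ ((critPoly γ).eval x) = (critPoly (ψ ∘ γ)).eval (ψ x) := by
  rw [← critPoly_map, eval_map, eval₂_at_apply]

variable [IsAlgClosed A] {γ : Fin r → A} {t : A} {n : ℕ} {i : Fin r}

theorem GaloisSwap.of_ringHom (ψ : A →+* L)
    (hψ : ∀ σ' : Gal(L/M), ∃ σ : Gal(A/B), ∀ x, ψ (σ x) = σ' (ψ x))
    (h : GaloisSwap M (ψ ∘ γ) (ψ t) n i) : GaloisSwap B γ t n i := by
  obtain ⟨u, v, huv, he, hu, σ', h1, h2, h3⟩ := h
  obtain ⟨u, rfl, hu'⟩ := exists_preimage_of_critIter ψ hu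
  obtain ⟨v, rfl, hv'⟩ := exists_preimage_of_eval_critPoly ψ (γ := γ) (x := (critPoly γ).eval u)
    (y := v) (by rw [map_eval_critPoly]; exact he.symm)
  obtain ⟨σ, hσ⟩ := hψ σ'
  refine ⟨u, v, fun h => huv (congrArg ψ h), hv'.symm, hu', σ, ψ.injective ?_, ψ.injective ?_, ?_⟩
  · rw [hσ, h1]
  · rw [hσ, h2]
  · intro l z hz hzu hzv
    refine ψ.injective ((hσ z).trans (h3 l _ ?_ (fun e => hzu (ψ.injective e))
      (fun e => hzv (ψ.injective e))))
    rw [← map_critIter, hz]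
    rfl

theorem GaloisTransitive.of_ringHom (ψ : A →+* L)
    (hψ : ∀ σ' : Gal(L/M), ∃ σ : Gal(A/B), ∀ x, ψ (σ x) = σ' (ψ x))
    (h : GaloisTransitive M (ψ ∘ γ) (ψ t) n i) :
    GaloisTransitive B γ t n i := by
  obtain ⟨x, hx, h⟩ := h
  obtain ⟨x, rfl, hx'⟩ := exists_preimage_of_critIter ψ hx
  refine ⟨x, hx', fun u v hu hv => ?_⟩
  obtain ⟨σ', h'⟩ := h (ψ u) (ψ v) (by rw [← map_eval_critPoly, ← map_add, hu])
    (by rw [← map_eval_critPoly, ← map_add, hv])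
  obtain ⟨σ, hσ⟩ := hψ σ'
  exact ⟨σ, ψ.injective (by rw [hσ, h'])⟩

theorem GaloisSiblings.of_ringHom (ψ : A →+* L)
    (hψ : ∀ σ' : Gal(L/M), ∃ σ : Gal(A/B), ∀ x, ψ (σ x) = σ' (ψ x))
    (h : GaloisSiblings M (ψ ∘ γ) (ψ t) n i) :
    GaloisSiblings B γ t n i := by
  obtain ⟨x, hx, w, hw, h⟩ := h
  obtain ⟨x, rfl, hx'⟩ := exists_preimage_of_critIter ψ hx
  obtain ⟨w, rfl, hw'⟩ := exists_preimage_of_eval_critPoly ψ (γ := γ) (x := x - t) (y := w)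
    (by rw [map_sub, ← hw, add_sub_cancel_right])
  refine ⟨x, hx', w, by rw [hw', sub_add_cancel], fun u v hu hv huw hvw => ?_⟩
  obtain ⟨σ', h1, h2⟩ := h (ψ u) (ψ v) (by rw [← map_eval_critPoly, ← map_add, hu])
    (by rw [← map_eval_critPoly, ← map_add, hv]) (fun e => huw (ψ.injective e))
    (fun e => hvw (ψ.injective e))
  obtain ⟨σ, hσ⟩ := hψ σ'
  exact ⟨σ, ψ.injective (by rw [hσ, h1]), ψ.injective (by rw [hσ, h2])⟩

end Transfer

/-! ### The three monodromy properties of the generic polynomial. -/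

section GenericMonodromy

variable {K B A : Type*} [Field K] [Field B] [Field A] [Algebra B A] [Algebra K B]
  [Algebra ℚ A] [Algebra.IsAlgebraic B A] [IsAlgClosed A] {r : ℕ} {γ : Fin r → B} {t : B}

/-- The properties of the generic polynomial follow from those over a power series field. -/
theorem galois_of_powerSeries
    (h : AlgebraicIndependent K (fun o : Option (Fin r) => o.elim t γ))
    (hgen : IntermediateField.adjoin K (Set.range fun o : Option (Fin r) => o.elim t γ) = ⊤)
    {M L : Type*} [Field M] [Algebra K M] [Field L] [Algebra M L] [IsAlgClosed L] [Algebra ℚ L]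
    {γ' : Fin r → M} {t' : M}
    (h' : AlgebraicIndependent K (fun o : Option (Fin r) => o.elim t' γ')) (n : ℕ) (i : Fin r) :
    (GaloisSwap M (algebraMap M L ∘ γ') (algebraMap M L t') n i →
      GaloisSwap B (algebraMap B A ∘ γ) (algebraMap B A t) n i) ∧
    (GaloisTransitive M (algebraMap M L ∘ γ') (algebraMap M L t') n i →
      GaloisTransitive B (algebraMap B A ∘ γ) (algebraMap B A t) n i) ∧
    (GaloisSiblings M (algebraMap M L ∘ γ') (algebraMap M L t') n i →
      GaloisSiblings B (algebraMap B A ∘ γ) (algebraMap B A t) n i) := by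
  obtain ⟨ψ, h1, h2, h3⟩ := exists_ringHom_of_algebraicIndependent (A := A) (L := L) h hgen h'
  rw [← h1, ← h2]
  exact ⟨fun h => .of_ringHom ψ h3 h, fun h => .of_ringHom ψ h3 h, fun h => .of_ringHom ψ h3 h⟩

theorem isIntegral_adjoin_of_mem {N : Type*} [Field N] [Algebra K N] {s : Set N} {x : N}
    (hx : x ∈ s) : IsIntegral (IntermediateField.adjoin K s) x :=
  isIntegral_algebraMap (R := IntermediateField.adjoin K s)
    (x := ⟨x, IntermediateField.subset_adjoin K s hx⟩)

theorem isGalois_algebraicClosure_fractionRing (k : Type*) [Field k] [CharZero k] :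
    IsGalois (FractionRing (PowerSeries k)) (AlgebraicClosure (FractionRing (PowerSeries k))) := by
  have : CharZero (PowerSeries k) := charZero_of_injective_algebraMap (PowerSeries.C_injective (R := k))
  have : CharZero (FractionRing (PowerSeries k)) :=
    charZero_of_injective_algebraMap (IsFractionRing.injective (PowerSeries k) _)
  infer_instance

/-- Power series near a degenerate configuration of critical points. -/
theorem exists_degenerate_family (hr : 1 ≤ r) {k : Type*} [Field k] [Algebra K k] [Algebra ℚ k]
    {c : Fin r → k} (hc : AlgebraicIndependent K c) (a : Fin r → K) {i : Fin r} (hi : a i = 0)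
    (n : ℕ) :
    ∃ (γ' : Fin r → PowerSeries k) (t' : PowerSeries k),
      PowerSeries.constantCoeff ∘ γ' = algebraMap K k ∘ a ∧
      critIter γ' t' n (t' - PowerSeries.X) = γ' i ∧
      AlgebraicIndependent K (fun o : Option (Fin r) => o.elim
        (algebraMap (PowerSeries k) (FractionRing (PowerSeries k)) t')
        (algebraMap (PowerSeries k) (FractionRing (PowerSeries k)) ∘ γ')) := by
  let M := FractionRing (PowerSeries k)
  let ι := algebraMap (PowerSeries k) M
  -- The perturbation `c l * X` preserves independence: `c l` is recovered from `γ' l` once `X` is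
  -- known to be algebraic over `K(γ', t')`.
  set γ' : Fin r → PowerSeries k := fun l =>
    PowerSeries.C (algebraMap K k (a l)) + PowerSeries.C (c l) * PowerSeries.X with hγ'
  have hγa : PowerSeries.constantCoeff ∘ γ' = algebraMap K k ∘ a := by
    funext l
    simp [hγ']
  obtain ⟨t', ht'⟩ := exists_param_of_degenerate hr (γ := γ') (i := i)
    (by rw [← Function.comp_apply (f := PowerSeries.constantCoeff), hγa]; simp [hi]) n
  refine ⟨γ', t', hγa, ht', ?_⟩
  set N := IntermediateField.adjoin K (Set.range fun o : Option (Fin r) =>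
    o.elim (ι t') (ι ∘ γ')) with hN
  have hγN : ∀ l, IsIntegral N (ι (γ' l)) := fun l => isIntegral_adjoin_of_mem ⟨some l, rfl⟩
  have htN : IsIntegral N (ι t') := isIntegral_adjoin_of_mem ⟨none, rfl⟩
  -- `X` is the difference of `t'` and `t' - X`, and the latter is algebraic over `N` as an iterated
  -- preimage of `γ' i`.
  have hX : IsIntegral N (ι PowerSeries.X) := by
    have : IsIntegral N (ι (t' - PowerSeries.X)) := by
      refine isIntegral_of_isIntegral_critIter (γ := ι ∘ γ') (t := ι t') (n := n) hγN htN ?_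
      rw [← map_critIter, ht']
      exact hγN i
    have h2 := htN.sub this
    rwa [map_sub, sub_sub_cancel] at h2
  refine algebraicIndependent_of_isIntegral hc _ _ hX fun l => ?_
  have haN : IsIntegral N (ι (PowerSeries.C (algebraMap K k (a l)))) := by
    have e : ι (PowerSeries.C (algebraMap K k (a l))) = algebraMap K M (a l) := by
      rw [IsScalarTower.algebraMap_apply K (PowerSeries k) M,
        PowerSeries.algebraMap_apply]
    rw [e, IsScalarTower.algebraMap_apply K N M]
    exact isIntegral_algebraMap
  have h3 := (hγN l).sub haN
  have hX0 : ι PowerSeries.X ≠ 0 := by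
    rw [map_ne_zero_iff _ (IsFractionRing.injective _ _)]
    exact PowerSeries.X_ne_zero
  have h4 : ι (PowerSeries.C (c l)) =
      (ι (γ' l) - ι (PowerSeries.C (algebraMap K k (a l)))) * (ι PowerSeries.X)⁻¹ := by
    rw [hγ', map_add, add_sub_cancel_left, map_mul, mul_inv_cancel_right₀ hX0]
  change IsIntegral N (ι (PowerSeries.C (c l)))
  rw [h4]
  exact h3.mul hX.inv

variable [CharZero K]

theorem galoisSwap_generic (hr : 1 ≤ r)
    (h : AlgebraicIndependent K (fun o : Option (Fin r) => o.elim t γ))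
    (hgen : IntermediateField.adjoin K (Set.range fun o : Option (Fin r) => o.elim t γ) = ⊤)
    (n : ℕ) (j : Fin r) : GaloisSwap B (algebraMap B A ∘ γ) (algebraMap B A t) n j := by
  obtain ⟨k, _, _, _, c, hc⟩ := exists_isAlgClosed_algebraicIndependent K r
  have hk : CharZero k := charZero_of_injective_algebraMap (algebraMap K k).injective
  have hcQ : AlgebraicIndependent ℚ c := hc.restrictScalars (algebraMap ℚ K).injective
  obtain ⟨τ, h1, h2, h3⟩ := exists_unique_critical_relation hr hcQ n j
  let M := FractionRing (PowerSeries k)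
  let L := AlgebraicClosure M
  let ι := algebraMap (PowerSeries k) M
  have hG : IsGalois M L := isGalois_algebraicClosure_fractionRing k
  set γ' : Fin r → M := fun l => ι (PowerSeries.C (c l)) with hγ'
  set t' : M := ι (PowerSeries.C τ + PowerSeries.X) with ht'
  have hind : AlgebraicIndependent K (fun o : Option (Fin r) => o.elim t' γ') := by
    set N := IntermediateField.adjoin K (Set.range fun o : Option (Fin r) => o.elim t' γ') with hN
    have hmem : ∀ l, γ' l ∈ N := fun l => IntermediateField.subset_adjoin _ _ ⟨some l, rfl⟩
    -- The parameter `τ` is a root of the critical relation, whose coefficients lie in `N`; hence `X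
    -- = t' - τ` is algebraic over `N` as well.
    have hτ : IsIntegral N (ι (PowerSeries.C τ)) := by
      let γ₀ : Fin r → N := fun l => ⟨γ' l, hmem l⟩
      refine ⟨relPoly γ₀ n (γ₀ j) (γ₀ j), (relPoly_monic hr _ _ _ _).1, ?_⟩
      have e : (relPoly c n (c j) (c j)).eval τ = 0 := by rw [eval_relPoly, h1, sub_self]
      have e' := congrArg (ι.comp PowerSeries.C) e
      rw [map_zero, ← eval₂_at_apply, ← eval_map, map_relPoly] at e'
      rw [← eval_map, map_relPoly]
      exact e'
    refine algebraicIndependent_of_isIntegral hc γ' t' ?_ fun l =>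
      isIntegral_adjoin_of_mem ⟨some l, rfl⟩
    have ht : IsIntegral N t' := isIntegral_adjoin_of_mem ⟨none, rfl⟩
    have := ht.sub hτ
    rwa [ht', map_add, add_sub_cancel_left] at this
  refine (galois_of_powerSeries (A := A) (L := L) h hgen hind n j).1 ?_
  have hindL := hind.map' (f := IsScalarTower.toAlgHom K M L) (algebraMap M L).injective
  have := galoisSwap_of_unique_critical_relation (M := M) (L := L) hcQ.injective h1 h2 h3 ?_
  · exact this
  · intro i
    refine critIter_ne_of_algebraicIndependent (K := K) hr
      (γ := algebraMap (PowerSeries k) L ∘ PowerSeries.C ∘ c) ?_ n i j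
    have e : (fun o : Option (Fin r) => o.elim
        (algebraMap (PowerSeries k) L (PowerSeries.C τ + PowerSeries.X))
        (algebraMap (PowerSeries k) L ∘ PowerSeries.C ∘ c)) =
        ⇑(IsScalarTower.toAlgHom K M L) ∘ fun o : Option (Fin r) => o.elim t' γ' := by
      funext o
      cases o <;> rfl
    rw [e]
    exact hindL

theorem galoisTransitive_generic (hr : 1 ≤ r)
    (h : AlgebraicIndependent K (fun o : Option (Fin r) => o.elim t γ))
    (hgen : IntermediateField.adjoin K (Set.range fun o : Option (Fin r) => o.elim t γ) = ⊤)
    (n : ℕ) (i : Fin r) : GaloisTransitive B (algebraMap B A ∘ γ) (algebraMap B A t) n i := by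
  obtain ⟨k, _, _, _, c, hc⟩ := exists_isAlgClosed_algebraicIndependent K r
  have hk : CharZero k := charZero_of_injective_algebraMap (algebraMap K k).injective
  let M := FractionRing (PowerSeries k)
  let L := AlgebraicClosure M
  have hG : IsGalois M L := isGalois_algebraicClosure_fractionRing k
  obtain ⟨γ', t', hγ', ht', hind⟩ := exists_degenerate_family hr hc 0 (i := i) rfl n
  refine (galois_of_powerSeries (A := A) (L := L) h hgen hind n i).2.1 ?_
  refine ⟨algebraMap (PowerSeries k) L (t' - PowerSeries.X), ?_, fun u v hu hv => ?_⟩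
  · have := map_critIter (algebraMap (PowerSeries k) L) γ' t' n (t' - PowerSeries.X)
    rw [ht'] at this
    exact this.symm
  · have key : ∀ w : L, (critPoly (algebraMap M L ∘ algebraMap (PowerSeries k) M ∘ γ')).eval w +
        algebraMap M L (algebraMap (PowerSeries k) M t') =
          algebraMap (PowerSeries k) L (t' - PowerSeries.X) →
        (critPoly (algebraMap (PowerSeries k) L ∘ γ')).eval w +
          algebraMap (PowerSeries k) L PowerSeries.X = 0 := by
      intro w hw
      rw [map_sub, eq_sub_iff_add_eq, add_right_comm] at hw
      exact add_eq_right.1 hw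
    refine exists_algEquiv_of_totally_degenerate (M := M) (L := L) ?_ (key u hu) (key v hv)
    rw [hγ']
    funext l
    simp

/-- The specialisation keeps `γ i` at 0 modulo `X` and moves a different critical point `γ j` away
from it, which is why a second index is required. -/
theorem galoisSiblings_generic (hr : 1 ≤ r)
    (h : AlgebraicIndependent K (fun o : Option (Fin r) => o.elim t γ))
    (hgen : IntermediateField.adjoin K (Set.range fun o : Option (Fin r) => o.elim t γ) = ⊤)
    (n : ℕ) {i j : Fin r} (hij : i ≠ j) :
    GaloisSiblings B (algebraMap B A ∘ γ) (algebraMap B A t) n i := by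
  obtain ⟨k, _, _, _, c, hc⟩ := exists_isAlgClosed_algebraicIndependent K r
  have hk : CharZero k := charZero_of_injective_algebraMap (algebraMap K k).injective
  let M := FractionRing (PowerSeries k)
  let L := AlgebraicClosure M
  have hG : IsGalois M L := isGalois_algebraicClosure_fractionRing k
  obtain ⟨γ', t', hγ', ht', hind⟩ := exists_degenerate_family hr hc
    (Function.update (0 : Fin r → K) j r) (i := i) (by rw [Function.update_of_ne hij]; rfl) n
  refine (galois_of_powerSeries (A := A) (L := L) h hgen hind n i).2.2 ?_
  have key : ∀ w : L, (critPoly (algebraMap M L ∘ algebraMap (PowerSeries k) M ∘ γ')).eval w +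
      algebraMap M L (algebraMap (PowerSeries k) M t') =
        algebraMap (PowerSeries k) L (t' - PowerSeries.X) ↔
      (critPoly (algebraMap (PowerSeries k) L ∘ γ')).eval w +
        algebraMap (PowerSeries k) L PowerSeries.X = 0 := by
    intro w
    rw [map_sub, eq_sub_iff_add_eq, add_right_comm]
    exact add_eq_right
  have hred : PowerSeries.constantCoeff ∘ γ' = Function.update (0 : Fin r → k) j r := by
    rw [hγ']
    funext l
    by_cases hl : l = j
    · subst hl
      simp
    · simp [Function.update_of_ne hl]
  obtain ⟨ρ, hρ, hρ'⟩ := exists_algEquiv_of_almost_degenerate (M := M) (L := L) hr hred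
  refine ⟨algebraMap (PowerSeries k) L (t' - PowerSeries.X), ?_, algebraMap _ L ρ,
    (key _).2 hρ, fun u v hu hv hu' hv' => ?_⟩
  · have := map_critIter (algebraMap (PowerSeries k) L) γ' t' n (t' - PowerSeries.X)
    rw [ht'] at this
    exact this.symm
  · obtain ⟨σ, hσ⟩ := hρ' u v ((key u).1 hu) ((key v).1 hv) hu' hv'
    refine ⟨σ, ?_, hσ⟩
    rw [IsScalarTower.algebraMap_apply (PowerSeries k) M L, AlgEquiv.commutes]

end GenericMonodromy

/-! ### The forest of backward orbits of the critical points -/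

section BackwardOrbit

variable {B A : Type*} [Field B] [Field A] [Algebra B A] [Algebra ℚ A] {r : ℕ}
  (γ : Fin r → B) (t : B)

theorem algEquiv_critIter (σ : Gal(A/B)) (n : ℕ) (x : A) :
    σ (critIter (algebraMap B A ∘ γ) (algebraMap B A t) n x) =
      critIter (algebraMap B A ∘ γ) (algebraMap B A t) n (σ x) := by
  have h := map_critIter (σ : A →+* A) (algebraMap B A ∘ γ) (algebraMap B A t) n x
  have h1 : ⇑(σ : A →+* A) ∘ algebraMap B A ∘ γ = algebraMap B A ∘ γ :=
    funext fun j => σ.commutes (γ j)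
  have h2 : (σ : A →+* A) (algebraMap B A t) = algebraMap B A t := σ.commutes t
  rw [h1, h2] at h
  exact h

variable (A) in
/-- The points some iterate of which is a critical point. -/
noncomputable def backwardOrbit : SubMulAction Gal(A/B) A where
  carrier := {x | ∃ m i, critIter (algebraMap B A ∘ γ) (algebraMap B A t) m x =
    algebraMap B A (γ i)}
  smul_mem' := by
    rintro σ x ⟨m, i, h⟩
    refine ⟨m, i, ?_⟩
    rw [AlgEquiv.smul_def, ← algEquiv_critIter, h, AlgEquiv.commutes]

variable {γ t}

/-- A fibre that contains no critical point has `r + 1` elements. -/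
theorem exists_labelling_fibre [IsAlgClosed A] {γ : Fin r → A} {t x : A}
    (hx : ∀ i, (critPoly γ).eval (γ i) + t ≠ x) :
    ∃ e : Fin (r + 1) → A, Function.Injective e ∧
      ∀ u, (critPoly γ).eval u + t = x ↔ ∃ j, e j = u := by
  classical
  have hm := critPoly_add_C_monic γ (t - x)
  have hroot : ∀ u, u ∈ (critPoly γ + C (t - x)).roots ↔ (critPoly γ).eval u + t = x := by
    intro u
    rw [mem_roots hm.1.ne_zero, IsRoot, eval_add, eval_C, ← add_sub_assoc, sub_eq_zero]
  have hnd : (critPoly γ + C (t - x)).roots.Nodup := by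
    rw [Multiset.nodup_iff_count_le_one]
    intro u
    by_contra! h
    rw [count_roots, one_lt_rootMultiplicity_iff_isRoot hm.1.ne_zero, derivative_add, derivative_C,
      add_zero] at h
    obtain ⟨i, rfl⟩ := eq_of_eval_derivative_critPoly h.2
    exact hx i ((hroot _).1 ((mem_roots hm.1.ne_zero).2 h.1))
  have hcard : (critPoly γ + C (t - x)).roots.toFinset.card = r + 1 := by
    rw [Multiset.toFinset_card_of_nodup hnd, splits_iff_card_roots.1 (IsAlgClosed.splits _), hm.2]
  let e := (Finset.equivFinOfCardEq hcard).symm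
  refine ⟨fun j => e j, fun a b h => e.injective (Subtype.ext h), fun u => ?_⟩
  rw [← hroot, ← Multiset.mem_toFinset]
  exact ⟨fun h => ⟨e.symm ⟨u, h⟩, by simp⟩, by rintro ⟨j, rfl⟩; exact (e j).2⟩

variable [IsAlgClosed A]

theorem exists_labelling_backwardOrbit
    (hne : ∀ m i l, critIter (algebraMap B A ∘ γ) (algebraMap B A t) (m + 1)
      (algebraMap B A (γ i)) ≠ algebraMap B A (γ l)) (x : backwardOrbit A γ t) :
    ∃ e : Fin (r + 1) → backwardOrbit A γ t, Function.Injective e ∧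
      ∀ u : A, (critPoly (algebraMap B A ∘ γ)).eval u + algebraMap B A t = x ↔
        ∃ j, (e j : A) = u := by
  obtain ⟨x, m, l, hx⟩ := x
  obtain ⟨e, he, he'⟩ := exists_labelling_fibre (γ := algebraMap B A ∘ γ) (t := algebraMap B A t)
    (x := x) fun i h => hne m i l (by
      rw [← hx, ← h]
      rfl)
  refine ⟨fun j => ⟨e j, m + 1, l, ?_⟩, fun a b h => he (congrArg Subtype.val h), he'⟩
  rw [critIter_succ, (he' _).2 ⟨j, rfl⟩, hx]

/-- The forest of iterated preimages of the critical points, for a polynomial without critical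
relations. -/
noncomputable def backwardForest (hγ : Function.Injective γ)
    (hne : ∀ m i l, critIter (algebraMap B A ∘ γ) (algebraMap B A t) (m + 1)
      (algebraMap B A (γ i)) ≠ algebraMap B A (γ l)) :
    RegularForest Gal(A/B) (backwardOrbit A γ t) (Fin r) (r + 1) where
  root i := ⟨algebraMap B A (γ i), 0, i, rfl⟩
  child x := (exists_labelling_backwardOrbit hne x).choose
  root_injective i j h := hγ ((algebraMap B A).injective (congrArg Subtype.val h))
  smul_root σ i := Subtype.ext (σ.commutes (γ i))
  child_inj {x y i j} h := by
    have hx := (exists_labelling_backwardOrbit hne x).choose_spec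
    have hy := (exists_labelling_backwardOrbit hne y).choose_spec
    obtain rfl : x = y :=
      Subtype.ext (((hx.2 _).2 ⟨i, congrArg Subtype.val h⟩).symm.trans ((hy.2 _).2 ⟨j, rfl⟩))
    exact ⟨rfl, hx.1 h⟩
  exists_smul_child σ x i := by
    have hx := (exists_labelling_backwardOrbit hne x).choose_spec
    have hy := (exists_labelling_backwardOrbit hne (σ • x)).choose_spec
    have h := (hx.2 _).2 ⟨i, rfl⟩
    obtain ⟨j, hj⟩ := (hy.2 (σ ((exists_labelling_backwardOrbit hne x).choose i : A))).1 (by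
      have h' := algEquiv_critIter γ t σ 1 ((exists_labelling_backwardOrbit hne x).choose i : A)
      exact h'.symm.trans (congrArg σ h))
    exact ⟨j, Subtype.ext hj.symm⟩

section

variable (hγ : Function.Injective γ)
    (hne : ∀ m i l, critIter (algebraMap B A ∘ γ) (algebraMap B A t) (m + 1)
      (algebraMap B A (γ i)) ≠ algebraMap B A (γ l))

theorem exists_child_backwardForest (x : backwardOrbit A γ t) (u : A) :
    (critPoly (algebraMap B A ∘ γ)).eval u + algebraMap B A t = x ↔
      ∃ j, ((backwardForest hγ hne).child x j : A) = u :=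
  (exists_labelling_backwardOrbit hne x).choose_spec.2 u

theorem eval_child_backwardForest (x : backwardOrbit A γ t) (j : Fin (r + 1)) :
    (critPoly (algebraMap B A ∘ γ)).eval ((backwardForest hγ hne).child x j : A) +
      algebraMap B A t = x :=
  (exists_child_backwardForest hγ hne x _).2 ⟨j, rfl⟩

theorem mem_level_backwardForest (i : Fin r) (n : ℕ) (x : backwardOrbit A γ t) :
    x ∈ (backwardForest hγ hne).level i n ↔
      critIter (algebraMap B A ∘ γ) (algebraMap B A t) n x = algebraMap B A (γ i) := by
  induction n generalizing x with
  | zero => exact Subtype.ext_iff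
  | succ n ih =>
    rw [critIter_succ]
    constructor
    · rintro ⟨y, hy, j, rfl⟩
      rw [eval_child_backwardForest]
      exact (ih y).1 hy
    · intro h
      let y : backwardOrbit A γ t :=
        ⟨(critPoly (algebraMap B A ∘ γ)).eval (x : A) + algebraMap B A t, n, i, h⟩
      obtain ⟨j, hj⟩ := (exists_child_backwardForest hγ hne y x).1 rfl
      exact ⟨y, (ih y).2 h, j, Subtype.ext hj⟩

theorem childrenTransitive_backwardForest {n : ℕ} {i : Fin r}
    (h : GaloisTransitive B (algebraMap B A ∘ γ) (algebraMap B A t) n i) :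
    (backwardForest hγ hne).ChildrenTransitive n i := by
  obtain ⟨x, hx, h⟩ := h
  let x' : backwardOrbit A γ t := ⟨x, n, i, hx⟩
  refine ⟨x', (mem_level_backwardForest hγ hne i n x').2 hx, fun a b => ?_⟩
  obtain ⟨σ, hσ⟩ := h _ _ (eval_child_backwardForest hγ hne x' a)
    (eval_child_backwardForest hγ hne x' b)
  exact ⟨σ, Subtype.ext hσ⟩

theorem siblingsTransitive_backwardForest {n : ℕ} {i : Fin r}
    (h : GaloisSiblings B (algebraMap B A ∘ γ) (algebraMap B A t) n i) :
    (backwardForest hγ hne).SiblingsTransitive n i := by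
  obtain ⟨x, hx, w, hw, h⟩ := h
  let x' : backwardOrbit A γ t := ⟨x, n, i, hx⟩
  obtain ⟨c, rfl⟩ := (exists_child_backwardForest hγ hne x' w).1 hw
  refine ⟨x', (mem_level_backwardForest hγ hne i n x').2 hx, c, fun a b ha hb => ?_⟩
  obtain ⟨σ, hσ, hσ'⟩ := h _ _ (eval_child_backwardForest hγ hne x' a)
    (eval_child_backwardForest hγ hne x' b)
    (fun e => ha ((backwardForest hγ hne).child_inj (Subtype.ext e)).2)
    (fun e => hb ((backwardForest hγ hne).child_inj (Subtype.ext e)).2)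
  exact ⟨σ, Subtype.ext hσ, Subtype.ext hσ'⟩

theorem hasSiblingSwap_backwardForest {n : ℕ} {i : Fin r}
    (h : GaloisSwap B (algebraMap B A ∘ γ) (algebraMap B A t) n i) :
    (backwardForest hγ hne).HasSiblingSwap n i := by
  obtain ⟨u, v, huv, he, hu, σ, h1, h2, h3⟩ := h
  let x' : backwardOrbit A γ t :=
    ⟨(critPoly (algebraMap B A ∘ γ)).eval u + algebraMap B A t, n, i, hu⟩
  obtain ⟨a, ha⟩ := (exists_child_backwardForest hγ hne x' u).1 rfl
  obtain ⟨b, hb⟩ := (exists_child_backwardForest hγ hne x' v).1 (by rw [← he])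
  refine ⟨x', (mem_level_backwardForest hγ hne i n x').2 hu, a, b, ?_, σ, ?_, ?_, ?_⟩
  · rintro rfl
    exact huv (ha.symm.trans hb)
  · exact Subtype.ext (by rw [SubMulAction.val_smul, ha, hb]; exact h1)
  · exact Subtype.ext (by rw [SubMulAction.val_smul, ha, hb]; exact h2)
  · intro l z hz hza hzb
    refine Subtype.ext (h3 l z ((mem_level_backwardForest hγ hne l (n + 1) z).1 hz)
      (fun e => hza (Subtype.ext (e.trans ha.symm))) (fun e => hzb (Subtype.ext (e.trans hb.symm))))

end

/-- The Galois group of the generic polynomial acts on the iterated preimages of the critical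
points through a product of full iterated wreath products. -/
theorem exists_surjective_iteratedWreath {K : Type*} [Field K] [CharZero K] [Algebra K B]
    [Algebra.IsAlgebraic B A] (hr : 1 ≤ r)
    (h : AlgebraicIndependent K (fun o : Option (Fin r) => o.elim t γ))
    (hgen : IntermediateField.adjoin K (Set.range fun o : Option (Fin r) => o.elim t γ) = ⊤)
    (n : ℕ) :
    ∃ Θ : Gal(A/B) →* (Fin r → iteratedWreath (r + 1) n), Function.Surjective Θ ∧
      ∀ σ, σ ∈ Θ.ker ↔ ∀ i x, critIter (algebraMap B A ∘ γ) (algebraMap B A t) n x =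
        algebraMap B A (γ i) → σ x = x := by
  have hγ : Function.Injective γ := fun i j e => Option.some_injective _ (h.injective e)
  let _ : Algebra K A := ((algebraMap B A).comp (algebraMap K B)).toAlgebra
  have _ : IsScalarTower K B A := IsScalarTower.of_algebraMap_eq fun _ => rfl
  have hA : AlgebraicIndependent K (fun o : Option (Fin r) =>
      o.elim (algebraMap B A t) (algebraMap B A ∘ γ)) := by
    have e : (fun o : Option (Fin r) => o.elim (algebraMap B A t) (algebraMap B A ∘ γ)) =
        ⇑(IsScalarTower.toAlgHom K B A) ∘ fun o : Option (Fin r) => o.elim t γ := by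
      funext o
      cases o <;> rfl
    rw [e]
    exact h.map' (algebraMap B A).injective
  have hne := critIter_ne_of_algebraicIndependent hr hA
  let T := backwardForest hγ hne
  refine ⟨T.portraitHom n, T.portraitHom_surjective
    (fun m i => childrenTransitive_backwardForest hγ hne (galoisTransitive_generic hr h hgen m i))
    (fun m i => ?_)
    (fun m i => hasSiblingSwap_backwardForest hγ hne (galoisSwap_generic hr h hgen m i)) n,
    fun σ => ?_⟩
  · by_cases hj : ∃ j, i ≠ j
    · obtain ⟨j, hj⟩ := hj
      exact siblingsTransitive_backwardForest hγ hne (galoisSiblings_generic hr h hgen m hj)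
    -- With a single critical point the degree is 2, and a child has only one sibling.
    · push Not at hj
      obtain rfl : r = 1 := by
        have : Fintype.card (Fin r) ≤ 1 := Fintype.card_le_one_iff.2 fun a b => by
          rw [← hj a, ← hj b]
        rw [Fintype.card_fin] at this
        omega
      obtain ⟨x, hx, -⟩ := childrenTransitive_backwardForest hγ hne
        (galoisTransitive_generic hr h hgen m i)
      refine ⟨x, hx, 0, fun a b ha hb => ⟨1, one_smul _ _, ?_⟩⟩
      obtain rfl : a = b := by omega
      exact one_smul _ _
  · rw [T.mem_ker_portraitHom]
    refine forall_congr' fun i => ⟨fun H x hx => ?_, fun H z hz => ?_⟩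
    · exact congrArg Subtype.val
        (H ⟨x, n, i, hx⟩ ((mem_level_backwardForest hγ hne i n _).2 hx))
    · exact Subtype.ext (H z ((mem_level_backwardForest hγ hne i n z).1 hz))

end BackwardOrbit

/-! ### The generic monic polynomial -/

section Assembly

/-- The Galois group of a field generated by an invariant set, as a quotient of the absolute Galois
group. -/
theorem isGalois_adjoin_of_ker_eq {B A G : Type*} [Field B] [Field A] [Algebra B A] [CharZero B]
    [IsAlgClosed A] [Algebra.IsAlgebraic B A] [Group G] {S : Set A}
    (hS : ∀ σ : Gal(A/B), ∀ x ∈ S, σ x ∈ S) (Θ : Gal(A/B) →* G) (hΘ : Function.Surjective Θ)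
    (hker : ∀ σ, σ ∈ Θ.ker ↔ ∀ x ∈ S, σ x = x) :
    IsGalois B (IntermediateField.adjoin B S) ∧
      Nonempty (Gal(IntermediateField.adjoin B S/B) ≃* G) := by
  have _ : IsAlgClosure B A := ⟨inferInstance, inferInstance⟩
  have _ : Normal B A := IsAlgClosure.normal B A
  have _ : Normal B (IntermediateField.adjoin B S) := by
    refine IntermediateField.normal_iff_forall_map_le'.2 fun σ => ?_
    rw [IntermediateField.adjoin_map, IntermediateField.adjoin_le_iff]
    rintro _ ⟨x, hx, rfl⟩
    exact IntermediateField.subset_adjoin _ _ (hS σ x hx)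
  have e : (AlgEquiv.restrictNormalHom (F := B) (K₁ := A) (IntermediateField.adjoin B S)).ker =
      Θ.ker := by
    ext σ
    rw [IntermediateField.restrictNormalHom_ker, IntermediateField.mem_fixingSubgroup_iff, hker]
    exact IntermediateField.forall_mem_adjoin_smul_eq_self_iff B σ
  exact ⟨⟨⟩, ⟨(QuotientGroup.quotientKerEquivOfSurjective _
    (AlgEquiv.restrictNormalHom_surjective A)).symm.trans
      ((QuotientGroup.quotientMulEquivOfEq e).trans
        (QuotientGroup.quotientKerEquivOfSurjective _ hΘ))⟩⟩

theorem exists_eq_critPoly_add_C {Ω : Type*} [Field Ω] [IsAlgClosed Ω] [Algebra ℚ Ω] {r : ℕ}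
    {p : Polynomial Ω} (hp : p.Monic) (hr : p.natDegree = r + 1) :
    ∃ γ : Fin r → Ω, p = critPoly γ + C (p.coeff 0) := by
  have _ : CharZero Ω := algebraRat.charZero Ω
  have hc : (derivative p).coeff r = r + 1 := by
    rw [coeff_derivative, ← hr, hp.coeff_natDegree, one_mul]
  have hd : (derivative p).natDegree = r := by
    refine le_antisymm ((natDegree_derivative_le p).trans (by omega)) (le_natDegree_of_ne_zero ?_)
    rw [hc]
    exact_mod_cast r.succ_ne_zero
  have hs := IsAlgClosed.splits (derivative p)
  have hprod := hs.eq_prod_roots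
  rw [leadingCoeff, hd, hc] at hprod
  have hcard : (derivative p).roots.card = r := (splits_iff_card_roots.1 hs).trans hd
  obtain ⟨l, hl⟩ := Quot.exists_rep (derivative p).roots
  replace hl : (l : Multiset Ω) = (derivative p).roots := hl
  rw [← hl, Multiset.coe_card] at hcard
  subst hcard
  refine ⟨l.get, eq_of_derivative_eq ?_ ?_⟩
  · rw [derivative_add, derivative_C, add_zero, derivative_critPoly, hprod, ← hl]
    have e := Fin.univ_val_map l.get
    rw [List.ofFn_get] at e
    rw [← e, Multiset.map_map]
    rfl
  · rw [coeff_add, coeff_C_zero, coeff_zero_eq_eval_zero (critPoly _), critPoly_eval_zero, zero_add]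

variable {F : Type*} [Field F] {r : ℕ} (s : Fin r → F) (t : F)

theorem degree_sum_add_C_lt :
    (∑ i : Fin r, C (s i) * X ^ (r + 1 - (i.val + 1)) + C t).degree < (r + 1 : ℕ) := by
  refine (degree_add_le _ _).trans_lt (max_lt ?_ ?_)
  · refine (degree_sum_le _ _).trans_lt ((Finset.sup_lt_iff (WithBot.bot_lt_coe _)).2 fun i _ => ?_)
    refine (degree_C_mul_X_pow_le _ _).trans_lt ?_
    exact_mod_cast (by omega : r + 1 - (i.val + 1) < r + 1)
  · exact degree_C_le.trans_lt (by exact_mod_cast r.succ_pos)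

theorem monicPoly_monic : (monicPoly (r + 1) s t).Monic := by
  rw [monicPoly, add_assoc]
  exact monic_X_pow_add (degree_sum_add_C_lt s t)

theorem natDegree_monicPoly : (monicPoly (r + 1) s t).natDegree = r + 1 := by
  rw [monicPoly, add_assoc, natDegree_add_eq_left_of_degree_lt, natDegree_X_pow]
  rw [degree_X_pow]
  exact degree_sum_add_C_lt s t

theorem coeff_zero_monicPoly : (monicPoly (r + 1) s t).coeff 0 = t := by
  rw [monicPoly, coeff_add, coeff_add, coeff_C_zero, coeff_X_pow, finsetSum_coeff,
    Finset.sum_eq_zero fun i _ => ?_]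
  · simp
  · rw [coeff_C_mul_X_pow, if_neg (by have := i.isLt; omega)]

theorem coeff_monicPoly (i : Fin r) : (monicPoly (r + 1) s t).coeff (r - i) = s i := by
  have := i.isLt
  rw [monicPoly, coeff_add, coeff_add, coeff_X_pow, if_neg (by omega), coeff_C,
    if_neg (by omega), finsetSum_coeff, Finset.sum_eq_single (M := F) (ι := Fin (r + 1 - 1)) i]
  · rw [coeff_C_mul_X_pow, if_pos (by omega)]
    simp
  · intro j _ hj
    have := j.isLt
    rw [coeff_C_mul_X_pow, if_neg]
    intro h
    exact hj (Fin.ext (by omega))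
  · exact fun h => absurd (Finset.mem_univ _) h

variable {s t} {Ω : Type*} [Field Ω] [Algebra F Ω]

theorem aeval_mem_intermediateField (E : IntermediateField F Ω) (f : F[X]) {x : Ω} (hx : x ∈ E) :
    aeval x f ∈ E := by
  have := aeval_algebraMap_apply Ω (⟨x, hx⟩ : E) f
  rw [IntermediateField.algebraMap_apply] at this
  rw [this]
  exact SetLike.coe_mem _

/-- Each critical point is the n-th image under `f` of one of its n-th preimages, and these exist
because `f` is surjective on `Ω`. -/
theorem criticalField_le_preimageField [IsAlgClosed Ω] {f : F[X]} (hf : f.Monic)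
    (hd : f.natDegree ≠ 0) (n : ℕ) : criticalField Ω f ≤ preimageField Ω f n := by
  refine IntermediateField.adjoin_le_iff.2 fun β hβ => ?_
  have hsurj : Function.Surjective fun y : Ω => aeval y f := by
    intro y
    have hm : (f.map (algebraMap F Ω)).natDegree = f.natDegree := hf.natDegree_map _
    obtain ⟨x, hx⟩ := IsAlgClosed.exists_root (f.map (algebraMap F Ω) - C y) fun h => hd (by
      rw [← hm, ← natDegree_sub_C (a := y), natDegree_eq_zero_iff_degree_le_zero.2 h.le])
    rw [IsRoot, eval_sub, eval_C, sub_eq_zero, eval_map_algebraMap] at hx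
    exact ⟨x, hx⟩
  obtain ⟨x, hx⟩ := hsurj.iterate n β
  have hx' : x ∈ preimageField Ω f n :=
    IntermediateField.subset_adjoin _ _ (Set.mem_biUnion hβ hx)
  have key : ∀ m, (fun y : Ω => aeval y f)^[m] x ∈ preimageField Ω f n := by
    intro m
    induction m with
    | zero => exact hx'
    | succ m ih =>
      rw [Function.iterate_succ_apply']
      exact aeval_mem_intermediateField _ _ ih
  rw [← hx]
  exact key n

/-- The critical points of the generic monic polynomial, together with its constant term, are
algebraically independent and generate the splitting field of the derivative. -/
theorem exists_critical_parametrization {K : Type*} [Field K] [CharZero K] [Algebra K F]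
    [Algebra K Ω] [IsScalarTower K F Ω] [Algebra ℚ Ω] [IsAlgClosed Ω]
    (hindep : AlgebraicIndependent K (fun o : Option (Fin r) => o.elim t s))
    (hgen : IntermediateField.adjoin K (insert t (Set.range s)) = ⊤) :
    ∃ γ : Fin r → criticalField Ω (monicPoly (r + 1) s t),
      (monicPoly (r + 1) s t).map (algebraMap F Ω) =
        critPoly (algebraMap (criticalField Ω (monicPoly (r + 1) s t)) Ω ∘ γ) +
          C (algebraMap F Ω t) ∧
      AlgebraicIndependent K (fun o : Option (Fin r) => o.elim (algebraMap F _ t) γ) ∧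
      IntermediateField.adjoin K
        (Set.range fun o : Option (Fin r) => o.elim (algebraMap F _ t) γ) = ⊤ := by
  set f := monicPoly (r + 1) s t with hf
  obtain ⟨γ', hγ'⟩ := exists_eq_critPoly_add_C (Ω := Ω) (r := r)
    ((monicPoly_monic s t).map (algebraMap F Ω))
    (by rw [(monicPoly_monic s t).natDegree_map, natDegree_monicPoly])
  rw [← hf, coeff_map, hf, coeff_zero_monicPoly, ← hf] at hγ'
  have hcrit : ∀ x : Ω, x ∈ criticalPoints Ω f ↔ (derivative (critPoly γ')).eval x = 0 := by
    intro x
    have : derivative (critPoly γ') = (derivative f).map (algebraMap F Ω) := by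
      rw [← derivative_map, hγ', derivative_add, derivative_C, add_zero]
    rw [this, eval_map_algebraMap]
    rfl
  let γ : Fin r → criticalField Ω f := fun j => ⟨γ' j, IntermediateField.subset_adjoin _ _
    ((hcrit _).2 (eval_derivative_critPoly_self γ' j))⟩
  set N := IntermediateField.adjoin K
    (Set.range fun o : Option (Fin r) => o.elim (algebraMap F (criticalField Ω f) t) γ) with hN
  have htN : algebraMap F (criticalField Ω f) t ∈ N :=
    IntermediateField.subset_adjoin _ _ ⟨none, rfl⟩
  have hγN : ∀ j, γ j ∈ N := fun j => IntermediateField.subset_adjoin _ _ ⟨some j, rfl⟩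
  -- Apart from the constant term, the coefficients of `f` are rational polynomials in its critical
  -- points.
  have hsN : ∀ i, algebraMap F (criticalField Ω f) (s i) ∈ N := by
    intro i
    have _ : CharZero N := charZero_of_injective_algebraMap (algebraMap K N).injective
    let φ : N →+* Ω := (algebraMap (criticalField Ω f) Ω).comp (algebraMap N (criticalField Ω f))
    have h1 := critPoly_map φ fun j => (⟨γ j, hγN j⟩ : N)
    have h2 : algebraMap F Ω (s i) =
        φ ((critPoly fun j => (⟨γ j, hγN j⟩ : N)).coeff (r - i)) := by
      have hi := i.isLt
      rw [← coeff_map, h1, ← coeff_monicPoly s t, ← coeff_map, ← hf, hγ', coeff_add, coeff_C,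
        if_neg (by omega), add_zero]
      rfl
    have h3 : algebraMap F (criticalField Ω f) (s i) =
        algebraMap N _ ((critPoly fun j => (⟨γ j, hγN j⟩ : N)).coeff (r - i)) :=
      (algebraMap (criticalField Ω f) Ω).injective h2
    rw [h3]
    exact SetLike.coe_mem _
  refine ⟨γ, hγ', ?_, ?_⟩
  -- The independent family formed by `t` and `s` lies in `N`, which is generated by equally many
  -- elements.
  · have hy : AlgebraicIndependent K (⇑(IsScalarTower.toAlgHom K F (criticalField Ω f)) ∘
        fun o : Option (Fin r) => o.elim t s) :=
      hindep.map' (algebraMap F (criticalField Ω f)).injective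
    refine hy.of_isAlgebraic_adjoin fun o => ?_
    cases o with
    | none => exact isAlgebraic_algebraMap (⟨_, htN⟩ : N)
    | some i => exact isAlgebraic_algebraMap (⟨_, hsN i⟩ : N)
  · have hF : ∀ a : F, algebraMap F (criticalField Ω f) a ∈ N := by
      have : IntermediateField.adjoin K (insert t (Set.range s)) ≤
          N.comap (IsScalarTower.toAlgHom K F (criticalField Ω f)) := by
        rw [IntermediateField.adjoin_le_iff, Set.insert_subset_iff]
        refine ⟨htN, ?_⟩
        rintro _ ⟨i, rfl⟩
        exact hsN i
      intro a
      exact this (hgen ▸ IntermediateField.mem_top)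
    rw [eq_top_iff]
    rintro ⟨x, hx⟩ -
    induction hx using IntermediateField.adjoin_induction with
    | mem x hx =>
      obtain ⟨j, rfl⟩ := eq_of_eval_derivative_critPoly ((hcrit x).1 hx)
      exact hγN j
    | algebraMap a => exact hF a
    | add x y hx hy h1 h2 => exact add_mem h1 h2
    | inv x hx h1 => exact inv_mem h1
    | mul x y hx hy h1 h2 => exact mul_mem h1 h2

/-- The field generated by the `n`-th preimages of the critical points of the generic polynomial,
over the field generated by the critical points and the constant term. -/
theorem isGalois_adjoin_critIter {K B Ω : Type*} [Field K] [CharZero K] [Field B] [Algebra K B]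
    [Field Ω] [Algebra B Ω] [IsAlgClosed Ω] [Algebra ℚ Ω] {r : ℕ} (hr : 1 ≤ r) {γ : Fin r → B}
    {t : B} (hγ : AlgebraicIndependent K (fun o : Option (Fin r) => o.elim t γ))
    (hgen : IntermediateField.adjoin K (Set.range fun o : Option (Fin r) => o.elim t γ) = ⊤)
    (n : ℕ) {S : Set Ω} (hS : ∀ x, x ∈ S ↔
      ∃ i, critIter (algebraMap B Ω ∘ γ) (algebraMap B Ω t) n x = algebraMap B Ω (γ i)) :
    IsGalois B (IntermediateField.adjoin B S) ∧
      Nonempty (Gal(IntermediateField.adjoin B S/B) ≃* (Fin r → iteratedWreath (r + 1) n)) := by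
  -- `Ω` need not be algebraic over `B`. All solutions of the iterated equation already lie in the
  -- image of an algebraic closure, where the Galois group is computed.
  let A := AlgebraicClosure B
  have _ : CharZero B := charZero_of_injective_algebraMap (algebraMap K B).injective
  have _ : CharZero A := charZero_of_injective_algebraMap (algebraMap B A).injective
  let ψ : A →ₐ[B] Ω := IsAlgClosed.lift
  obtain ⟨Θ, hΘ, hker⟩ := exists_surjective_iteratedWreath (A := A) hr hγ hgen n
  let S' : Set A :=
    {x | ∃ i, critIter (algebraMap B A ∘ γ) (algebraMap B A t) n x = algebraMap B A (γ i)}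
  obtain ⟨hG, ⟨e⟩⟩ := isGalois_adjoin_of_ker_eq (S := S') (fun σ x ⟨i, hx⟩ => ⟨i, by
    rw [← algEquiv_critIter, hx, AlgEquiv.commutes]⟩) Θ hΘ fun σ => (hker σ).trans
      ⟨fun H x ⟨i, hx⟩ => H i x hx, fun H i x hx => H x ⟨i, hx⟩⟩
  have hψγ : ⇑(ψ : A →+* Ω) ∘ algebraMap B A ∘ γ = algebraMap B Ω ∘ γ :=
    funext fun j => ψ.commutes (γ j)
  have hψt : (ψ : A →+* Ω) (algebraMap B A t) = algebraMap B Ω t := ψ.commutes _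
  have himage : (ψ : A → Ω) '' S' = S := by
    ext y
    rw [hS]
    constructor
    · rintro ⟨x, ⟨i, hx⟩, rfl⟩
      have := map_critIter (ψ : A →+* Ω) (algebraMap B A ∘ γ) (algebraMap B A t) n x
      rw [hx, hψγ, hψt] at this
      exact ⟨i, this.symm.trans (ψ.commutes (γ i))⟩
    · rintro ⟨i, hy⟩
      obtain ⟨x, hx, hx'⟩ := exists_preimage_of_critIter (ψ : A →+* Ω) (γ := algebraMap B A ∘ γ)
        (t := algebraMap B A t) (x := algebraMap B A (γ i)) (n := n) (y := y) (by
          rw [hψγ, hψt]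
          exact hy.trans (ψ.commutes (γ i)).symm)
      exact ⟨x, ⟨i, hx'⟩, hx⟩
  have hE : (IntermediateField.adjoin B S').map ψ = IntermediateField.adjoin B S := by
    rw [IntermediateField.adjoin_map, himage]
  let e' := ((IntermediateField.adjoin B S').equivMap ψ).trans (IntermediateField.equivOfEq hE)
  exact ⟨.of_algEquiv e', ⟨(AlgEquiv.autCongr e').symm.trans e⟩⟩

theorem mem_iUnion_iteratedPreimage_iff [Algebra ℚ Ω] {f : F[X]} {γ : Fin r → Ω} {t : Ω}
    (hf : f.map (algebraMap F Ω) = critPoly γ + C t) (n : ℕ) (x : Ω) :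
    x ∈ (⋃ β ∈ criticalPoints Ω f, iteratedPreimage f n β) ↔ ∃ i, critIter γ t n x = γ i := by
  have haeval : (fun y : Ω => aeval y f) = fun y => (critPoly γ).eval y + t := by
    funext y
    rw [← eval_map_algebraMap, hf, eval_add, eval_C]
  have hd : (derivative f).map (algebraMap F Ω) = derivative (critPoly γ) := by
    rw [← derivative_map, hf, derivative_add, derivative_C, add_zero]
  simp only [Set.mem_iUnion, iteratedPreimage, criticalPoints, haeval, Set.mem_ofPred_eq,
    exists_prop, exists_eq_right']
  rw [← eval_map_algebraMap, hd]
  refine ⟨eq_of_eval_derivative_critPoly, ?_⟩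
  rintro ⟨i, hi⟩
  change (derivative (critPoly γ)).eval (critIter γ t n x) = 0
  rw [hi]
  exact eval_derivative_critPoly_self _ i

end Assembly

theorem proposition1p2 {K : Type*} [Field K] [NumberField K] (d : ℕ) (hd : 2 ≤ d) (n : ℕ)
    {F : Type*} [Field F] [Algebra K F] (s : Fin (d - 1) → F) (t : F)
    (hindep : AlgebraicIndependent K (fun o : Option (Fin (d - 1)) => o.elim t s))
    (hgen : IntermediateField.adjoin K (insert t (Set.range s)) = ⊤)
    (Ω : Type*) [Field Ω] [Algebra F Ω] [IsAlgClosed Ω] :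
    ∃ h : criticalField Ω (monicPoly d s t) ≤ preimageField Ω (monicPoly d s t) n,
      IsGalois (criticalField Ω (monicPoly d s t)) (IntermediateField.extendScalars h) ∧
      Nonempty (Gal(IntermediateField.extendScalars h / criticalField Ω (monicPoly d s t)) ≃*
        (Fin (d - 1) → iteratedWreath d n)) := by
  obtain ⟨r, rfl⟩ : ∃ r, d = r + 1 := ⟨d - 1, by omega⟩
  have hr : 1 ≤ r := by omega
  let _ : Algebra K Ω := ((algebraMap F Ω).comp (algebraMap K F)).toAlgebra
  have _ : IsScalarTower K F Ω := IsScalarTower.of_algebraMap_eq fun _ => rfl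
  have _ : CharZero Ω := charZero_of_injective_algebraMap (algebraMap K Ω).injective
  have h := criticalField_le_preimageField (Ω := Ω) (monicPoly_monic (r := r) s t)
    (by rw [natDegree_monicPoly]; omega) n
  refine ⟨h, ?_⟩
  obtain ⟨γ, hfγ, hγ, hγgen⟩ := exists_critical_parametrization (Ω := Ω) (r := r) hindep hgen
  have key := isGalois_adjoin_critIter (Ω := Ω) hr hγ hγgen n
    (mem_iUnion_iteratedPreimage_iff hfγ n)
  -- The preimages were adjoined to the critical field, whereas `preimageField` adjoins them to `F`;
  -- the two agree because the critical field is contained in the latter.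
  rw [← IntermediateField.extendScalars_adjoin h] at key
  exact key
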